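/- Let $G$ be a finite generalized dihedral group generated by $A$ and $t$: $A$ is an abelian subgroup of index $2$ in $G$, and $t\in G\setminus A$ is an involution with $tat=a^{-1}$ for all $a\in A$. Let $S\subseteq G\setminus\{e\}$ be inverse-closed with $|S|=4$ and $t\in S$, and let $\Gamma=\mathrm{Cay}(G,S)$ be the graph with vertex set $G$ in which $x,y$ are adjacent if and only if $x^{-1}y\in S$. Assume that $\Gamma$ is connected and admits a perfect code, i.e. a set $D\subseteq G$ such that every vertex of $\Gamma$ is equal or adjacent to exactly one element of $D$. For $s_0,s_1,s_2\in A$ let $n$ be the order of $s_0$, let $m$ be the least positive integer with $s_1^m\in\langle s_0\rangle$, and let $l$ be the least positive integer with $s_2^l\in\langle s_0,s_1\rangle$. For an integer $k$ put $\sigma(k)=(1-(-1)^k)/2$. (1) Suppose that $S=\{s_1,s_1^{-1},t,ts_0\}$ with $s_0,s_1\in A$, that $5\mid n$, and that, for at least one sign, $s_1^m=s_0^{5u/2\pm m}$ for some $u\in\{0,2,4,\ldots,2(n/5-1)\}$. Then the perfect codes of $\Gamma$ containing $t$ are exactly the sets $$\bigcup_{k=0}^{m-1}\ \bigcup_{u\in\{0,2,\ldots,2(n/5-1)\}}\left\{s_0^{5u/2+\epsilon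 k}s_1^{k}t,\ s_0^{3+5u/2+\epsilon k}s_1^{k}\right\},$$ where $\epsilon$ runs over those elements of $\{1,-1\}$ for which $s_1^m=s_0^{5u/2-\epsilon m}$ for some $u\in\{0,2,\ldots,2(n/5-1)\}$. (2) Call $(v,a,b)$ suitable if $v\in\{2,3,4\}$, $\{a,b\}=\{2+\sigma(v),v-\sigma(v)-1\}$, and there are $\alpha_1,\alpha_2\in\{0,1,\ldots,n/5-1\}$ and $j\in\{0,1,\ldots,m-1\}$ with $s_1^m=s_0^{5\alpha_1-am}$ and $s_2^l=s_0^{5\alpha_2-bl+aj}s_1^j$. Suppose that $S=\{t,ts_0,ts_1,ts_2\}$ with $s_0,s_1,s_2\in A$, that $5\mid n$, and that at least one suitable triple exists. Then the perfect codes of $\Gamma$ containing $t$ are exactly the sets $$\bigcup_{\alpha'=0}^{n/5-1}\ \bigcup_{j'=0}^{m-1}\ \bigcup_{k'=0}^{l-1}\left(\left\{s_0^{5\alpha'+aj'+bk'}s_1^{j'}s_2^{k'}t\right\}\cup\left\{s_0^{5\alpha'+aj'+bk'+v}s_1^{j'}s_2^{k'}\right\}\right),$$ where $(v,a,b)$ runs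 over the suitable triples. -/

import Mathlib

/-- `G` is the generalized dihedral group generated by its abelian subgroup `A` of index `2`
and the involution `t ∉ A`, which inverts every element of `A`. -/
structure IsGeneralizedDihedral {G : Type*} [Group G] (A : Subgroup G) (t : G) : Prop where
  index_two : A.index = 2
  comm : ∀ x ∈ A, ∀ y ∈ A, x * y = y * x
  order_two : orderOf t = 2
  notMem : t ∉ A
  conj : ∀ x ∈ A, t * x * t = x⁻¹

/-- `S` is an inverse-closed set of four non-identity elements whose Cayley graph is connected.
In `SimpleGraph.mulCayley S` the neighbours of `x` are the elements `x * s` with `s ∈ S`. -/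
structure IsQuarticConnectionSet {G : Type*} [Group G] (S : Set G) : Prop where
  one_notMem : (1 : G) ∉ S
  inv_mem : ∀ x ∈ S, x⁻¹ ∈ S
  card_four : S.ncard = 4
  connected : (SimpleGraph.mulCayley S).Connected

/-- Every vertex is dominated by (equal or adjacent to) exactly one vertex of `D`. -/
def IsPerfectCode {V : Type*} (Γ : SimpleGraph V) (D : Set V) : Prop :=
  ∀ x : V, ∃! d : V, d ∈ D ∧ (d = x ∨ Γ.Adj d x)

/-- `5 ∣ o(s₀)` and `s₁ ^ m = s₀ ^ (5 w + δ m)` for some `0 ≤ w ≤ o(s₀) / 5 - 1`. -/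
def ConditionOne {G : Type*} [Group G] (s₀ s₁ : G) (m : ℕ) (δ : ℤ) : Prop :=
  5 ∣ orderOf s₀ ∧ ∃ w < orderOf s₀ / 5, s₁ ^ m = s₀ ^ (5 * (w : ℤ) + δ * (m : ℤ))

/-- The union of the pairs `{s₀ ^ (5 w + ε k) s₁ ^ k t, s₀ ^ (3 + 5 w + ε k) s₁ ^ k}` over
`0 ≤ k ≤ m - 1` and `0 ≤ w ≤ o(s₀) / 5 - 1`. -/
def codeOne {G : Type*} [Group G] (t s₀ s₁ : G) (m : ℕ) (ε : ℤ) : Set G :=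
  ⋃ k ∈ Finset.range m, ⋃ w ∈ Finset.range (orderOf s₀ / 5),
    {s₀ ^ (5 * (w : ℤ) + ε * (k : ℤ)) * s₁ ^ k * t,
      s₀ ^ (3 + 5 * (w : ℤ) + ε * (k : ℤ)) * s₁ ^ k}

/-- `σ(k) = (1 - (-1) ^ k) / 2`, that is, `0` for even `k` and `1` for odd `k`. -/
def parity (k : ℕ) : ℤ := (1 - (-1) ^ k) / 2

/-- `v ∈ {2, 3, 4}` and `{a, b} = {2 + σ(v), v - σ(v) - 1}`. -/
def AdmissibleTriple (v : ℕ) (a b : ℤ) : Prop :=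
  v ∈ ({2, 3, 4} : Set ℕ) ∧
    ({a, b} : Set ℤ) = {2 + parity v, (v : ℤ) - parity v - 1}

/-- `5 ∣ o(s₀)`, `s₁ ^ m = s₀ ^ (5 α₁ - a m)` and `s₂ ^ l = s₀ ^ (5 α₂ - b l + a j) s₁ ^ j` for
some `0 ≤ α₁, α₂ ≤ o(s₀) / 5 - 1` and `0 ≤ j ≤ m - 1`. -/
def ConditionTwo {G : Type*} [Group G] (s₀ s₁ s₂ : G) (m l : ℕ) (a b : ℤ) : Prop :=
  5 ∣ orderOf s₀ ∧
    ∃ α₁ < orderOf s₀ / 5, ∃ α₂ < orderOf s₀ / 5, ∃ j < m,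
      s₁ ^ m = s₀ ^ (5 * (α₁ : ℤ) - a * (m : ℤ)) ∧
      s₂ ^ l = s₀ ^ (5 * (α₂ : ℤ) - b * (l : ℤ) + a * (j : ℤ)) * s₁ ^ j

/-- The union of `{s₀ ^ (5 α + a j + b k) s₁ ^ j s₂ ^ k t}` and
`{s₀ ^ (5 α + a j + b k + v) s₁ ^ j s₂ ^ k}` over `0 ≤ α ≤ o(s₀) / 5 - 1`, `0 ≤ j ≤ m - 1`,
`0 ≤ k ≤ l - 1`. -/
def codeTwo {G : Type*} [Group G] (t s₀ s₁ s₂ : G) (m l v : ℕ) (a b : ℤ) : Set G :=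
  ⋃ α ∈ Finset.range (orderOf s₀ / 5), ⋃ j ∈ Finset.range m, ⋃ k ∈ Finset.range l,
    ({s₀ ^ (5 * (α : ℤ) + a * (j : ℤ) + b * (k : ℤ)) * s₁ ^ j * s₂ ^ k * t} ∪
      {s₀ ^ (5 * (α : ℤ) + a * (j : ℤ) + b * (k : ℤ) + (v : ℤ)) * s₁ ^ j * s₂ ^ k})

/-!
A perfect code of `Γ` pulls back to a perfect code of a 4-regular bipartite lattice graph covering
`Γ`: for `S = {t, t s₀, t s₁, t s₂}` the two parts are copies of `ℤ³`, indexing the words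
`s₀ ^ i s₁ ^ j s₂ ^ k t` and `s₀ ^ i s₁ ^ j s₂ ^ k`, and for `S = {s₁, s₁⁻¹, t, t s₀}` the graph is
the square grid.

The codewords at distance three from a codeword are described by a bijection `w` from the four
directions to the nonzero residues modulo `5`: going along `e i`, along `e j` and back along `e k`
leads to a codeword if `w i + w j = w k`. The same `w` works around these new codewords, so a code
containing `0` consists of the zeros of a linear form modulo `5`. The bijections arising from linear
forms give the admissible parameters, and a code of the lattice descends to `Γ` if and only if its
form vanishes on the relations between `s₀`, `s₁`, `s₂`. These are generated by `s₀ ^ n = 1` and the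
relations expressing `s₁ ^ m` and `s₂ ^ l`.
-/

open Function

/-! ### Labellings by the nonzero residues modulo 5 -/

/-- Exactly one of the propositions `p` and `q i` holds. -/
def ExactlyOne {ι : Type*} (p : Prop) (q : ι → Prop) : Prop :=
  ∃! o : Option ι, o.elim p q

namespace ExactlyOne

variable {ι κ : Type*} {p : Prop} {q : ι → Prop}

lemma iff_cover_disjoint_unique :
    ExactlyOne p q ↔ (p ∨ ∃ i, q i) ∧ (p → ∀ i, ¬ q i) ∧ ∀ i j, q i → q j → i = j := by
  constructor
  · rintro ⟨o, ho, huniq⟩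
    refine ⟨?_, fun hp i hi => ?_, fun i j hi hj => ?_⟩
    · cases o with
      | none => exact .inl ho
      | some i => exact .inr ⟨i, ho⟩
    · exact absurd ((huniq none hp).trans (huniq (some i) hi).symm) (by simp)
    · exact Option.some_injective ι ((huniq (some i) hi).trans (huniq (some j) hj).symm)
  · rintro ⟨hp | ⟨i, hi⟩, hdisj, huniq⟩
    · exact ⟨none, hp, fun o ho => by
        cases o with
        | none => rfl
        | some i => exact (hdisj hp i ho).elim⟩
    · exact ⟨some i, hi, fun o ho => by
        cases o with
        | none => exact (hdisj ho i hi).elim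
        | some j => exact congrArg some (huniq j i ho hi)⟩

lemma cover (h : ExactlyOne p q) : p ∨ ∃ i, q i := (iff_cover_disjoint_unique.1 h).1

lemma disjoint (h : ExactlyOne p q) (hp : p) (i : ι) : ¬ q i :=
  (iff_cover_disjoint_unique.1 h).2.1 hp i

lemma unique (h : ExactlyOne p q) {i j : ι} (hi : q i) (hj : q j) : i = j :=
  (iff_cover_disjoint_unique.1 h).2.2 i j hi hj

lemma comp_equiv_iff (σ : κ ≃ ι) : ExactlyOne p (fun i => q (σ i)) ↔ ExactlyOne p q :=
  (Equiv.optionCongr σ).existsUnique_congr fun o => by cases o <;> rfl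

end ExactlyOne

instance fact_prime_five : Fact (Nat.Prime 5) := ⟨Nat.prime_five⟩

/-- A labelling of four directions by the four nonzero residues modulo `5`. -/
structure IsLabelling (w : Fin 4 → ZMod 5) : Prop where
  injective : Injective w
  ne_zero : ∀ i, w i ≠ 0

namespace IsLabelling

variable {w : Fin 4 → ZMod 5}

lemma exists_eq (hw : IsLabelling w) {c : ZMod 5} (hc : c ≠ 0) : ∃ i, w i = c := by
  let f : Fin 4 → {c : ZMod 5 // c ≠ 0} := fun i => ⟨w i, hw.ne_zero i⟩
  have hf : Bijective f := (Fintype.bijective_iff_injective_and_card f).2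
    ⟨fun i j hij => hw.injective (congrArg Subtype.val hij), by decide⟩
  exact (hf.surjective ⟨c, hc⟩).imp fun i hi => congrArg Subtype.val hi

lemma mul_left (hw : IsLabelling w) {c : ZMod 5} (hc : c ≠ 0) : IsLabelling fun i => c * w i :=
  ⟨fun _ _ h => hw.injective (mul_left_cancel₀ hc h), fun i => mul_ne_zero hc (hw.ne_zero i)⟩

lemma exactlyOne_add_eq_zero (hw : IsLabelling w) (r : ZMod 5) :
    ExactlyOne (r = 0) fun i => r + w i = 0 := by
  rw [ExactlyOne.iff_cover_disjoint_unique]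
  refine ⟨?_, fun hr i hi => hw.ne_zero i (by simpa [hr] using hi), fun i j hi hj =>
    hw.injective (add_left_cancel (hi.trans hj.symm))⟩
  by_cases hr : r = 0
  · exact .inl hr
  · obtain ⟨i, hi⟩ := hw.exists_eq (neg_ne_zero.2 hr)
    exact .inr ⟨i, by rw [hi, add_neg_cancel]⟩

end IsLabelling

lemma exists_rel_self_of_odd_card {α : Type*} [Fintype α] (hα : Odd (Fintype.card α))
    {C : α → α → Prop} (symm : ∀ a b, C a b → C b a) (cover : ∀ a, ∃ b, C a b)
    (unique : ∀ a b b', C a b → C a b' → b = b') : ∃ a, C a a := by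
  classical
  choose f hf using cover
  have hinv : Involutive f := fun a => unique _ _ _ (hf (f a)) (symm _ _ (hf a))
  obtain ⟨a, ha⟩ := Equiv.Perm.exists_fixed_point_of_prime (p := 2) (n := 1)
    (σ := hinv.toPerm) hα.not_two_dvd_nat (Equiv.ext fun a => by simp [sq, hinv a])
  exact ⟨a, by simpa [show f a = a from ha] using hf a⟩

set_option maxRecDepth 100000 in
lemma exists_isLabelling_two_mul (g : Fin 4 → Fin 4) (hinj : Injective g)
    (h1 : ∀ j, g j ≠ j) (h2 : ∀ j, g (g j) ≠ j) :
    ∃ w, IsLabelling w ∧ ∀ j, 2 * w (g j) = w j := by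
  -- `g` is a four-cycle, and `3` is the inverse of `2`
  refine ⟨fun j => if j = 0 then 1 else if j = g 0 then 3 else if j = g (g 0) then 3 ^ 2 else 3 ^ 3,
    ⟨?_, ?_⟩, ?_⟩
  all_goals
    revert g
    decide

section Surroundings

variable {B : Fin 4 → Fin 4 → Fin 4 → Prop}

lemma exists_ne_diagonal (symm : ∀ i k j, B i k j → B k i j)
    (cover : ∀ i j, i ≠ j → ∃ k ≠ j, B i k j)
    (unique_mid : ∀ i k k' j, B i k j → B i k' j → k = k') (j : Fin 4) :
    ∃ l ≠ j, B l l j := by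
  have hodd : Odd (Fintype.card {i // i ≠ j}) := by
    revert j
    decide
  obtain ⟨⟨l, hl⟩, hB⟩ := exists_rel_self_of_odd_card hodd
    (C := fun i k => B i k j) (fun i k => symm i k j)
    (fun i => let ⟨k, hk, hB⟩ := cover i j i.2; ⟨⟨k, hk⟩, hB⟩)
    (fun i k k' h h' => Subtype.ext (unique_mid i k k' j h h'))
  exact ⟨l, hl, hB⟩

lemma rel_of_ne_diagonal (symm : ∀ i k j, B i k j → B k i j)
    (cover : ∀ i j, i ≠ j → ∃ k ≠ j, B i k j)
    (unique_mid : ∀ i k k' j, B i k j → B i k' j → k = k')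
    (unique_right : ∀ i k j j', B i k j → B i k j' → j = j') {g : Fin 4 → Fin 4}
    (hinj : Injective g) (hg : ∀ j, g j ≠ j) (hB : ∀ j, B (g j) (g j) j) {j a b : Fin 4}
    (haj : a ≠ j) (hag : a ≠ g j) (hbj : b ≠ j) (hbg : b ≠ g j) (hab : a ≠ b) : B a b j := by
  obtain ⟨k, hk, hBk⟩ := cover a j haj
  have hka : k ≠ a := by
    rintro rfl
    obtain ⟨j', rfl⟩ := Finite.surjective_of_injective hinj k
    exact hag (congrArg g (unique_right _ _ _ _ (hB j') hBk))
  have hkg : k ≠ g j := by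
    rintro rfl
    exact hag (unique_mid _ _ _ _ (symm _ _ _ hBk) (hB j))
  have := hg j
  have hkb : k = b := by lia
  exact hkb ▸ hBk

lemma exists_isLabelling_of_rel (symm : ∀ i k j, B i k j → B k i j)
    (cover : ∀ i j, i ≠ j → ∃ k ≠ j, B i k j)
    (unique_mid : ∀ i k k' j, B i k j → B i k' j → k = k')
    (unique_right : ∀ i k j j', B i k j → B i k j' → j = j') :
    ∃ w, IsLabelling w ∧ ∀ i k j, w i + w k = w j → B i k j := by
  choose g hg hB using exists_ne_diagonal symm cover unique_mid
  have hinj : Injective g := fun i j h => unique_right (g i) (g i) i j (hB i) (h ▸ hB j)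
  have off_diagonal {j a b} :=
    rel_of_ne_diagonal symm cover unique_mid unique_right hinj hg hB (j := j) (a := a) (b := b)
  have hgg : ∀ j, g (g j) ≠ j := by
    intro j hj
    obtain ⟨a, b, haj, hag, hbj, hbg, hab⟩ :
        ∃ a b : Fin 4, a ≠ j ∧ a ≠ g j ∧ b ≠ j ∧ b ≠ g j ∧ a ≠ b := by
      generalize g j = z
      clear * -
      decide +revert
    refine hg j (unique_right a b _ _ ?_ (off_diagonal haj hag hbj hbg hab))
    exact off_diagonal hag (by rwa [hj]) hbg (by rwa [hj]) hab
  obtain ⟨w, hw, hdouble⟩ := exists_isLabelling_two_mul g hinj hg hgg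
  refine ⟨w, hw, fun i k j hsum => ?_⟩
  by_cases hik : i = k
  · subst hik
    have hi : w i = w (g j) := mul_left_cancel₀ (by decide : (2 : ZMod 5) ≠ 0)
      (by rw [hdouble, ← hsum, two_mul])
    obtain rfl := hw.injective hi
    exact hB j
  · have hsum' : w i + w k = w (g j) + w (g j) := by rw [hsum, ← hdouble, two_mul]
    refine off_diagonal ?_ ?_ ?_ ?_ hik
    · rintro rfl
      exact hw.ne_zero k (by simpa using hsum)
    · rintro rfl
      exact hik (hw.injective (add_left_cancel hsum').symm)
    · rintro rfl
      exact hw.ne_zero i (by simpa using hsum)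
    · rintro rfl
      exact hik (hw.injective (add_right_cancel hsum'))

end Surroundings

namespace IsLabelling

variable {w w' : Fin 4 → ZMod 5}

lemma exists_multiples (hw : IsLabelling w) (k : Fin 4) :
    ∃ r l m, w r = 3 * w k ∧ w l = 4 * w k ∧ w m = 2 * w k ∧ [k, r, l, m].Nodup ∧
      ∀ n, n ∈ [k, r, l, m] := by
  have exists_multiple : ∀ {c : ZMod 5}, c ≠ 0 → ∃ i, w i = c * w k := fun hc =>
    hw.exists_eq (mul_ne_zero hc (hw.ne_zero k))
  obtain ⟨r, hr⟩ := exists_multiple (by decide : (3 : ZMod 5) ≠ 0)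
  obtain ⟨l, hl⟩ := exists_multiple (by decide : (4 : ZMod 5) ≠ 0)
  obtain ⟨m, hm⟩ := exists_multiple (by decide : (2 : ZMod 5) ≠ 0)
  have multiples : ∀ u : ZMod 5, u ≠ 0 → [u, 3 * u, 4 * u, 2 * u].Nodup ∧
      ∀ c ≠ 0, c ∈ [u, 3 * u, 4 * u, 2 * u] := by decide
  have hlist : [k, r, l, m].map w = [w k, 3 * w k, 4 * w k, 2 * w k] := by
    simp only [List.map, hr, hl, hm]
  obtain ⟨hnodup, hmem⟩ := multiples (w k) (hw.ne_zero k)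
  rw [← hlist] at hnodup hmem
  exact ⟨r, l, m, hr, hl, hm, hnodup.of_map, fun n =>
    (List.mem_map_of_injective hw.injective).1 (hmem (w n) (hw.ne_zero n))⟩

lemma eq_or_swap (hw : IsLabelling w) (hw' : IsLabelling w') {i j k : Fin 4} (hk : w' k = w k)
    (hsum : w i + w j = w k) (hsum' : w' i + w' j = w' k) :
    w' = w ∨ ∃ r l m, w r + w l = w m ∧ w' r + w' m = w' l ∧ w' m + w' m = w' r ∧
      (i = r ∧ j = r ∨ i = l ∧ j = m ∨ i = m ∧ j = l) := by
  obtain ⟨r, l, m, hr, hl, hm, hnodup, hall⟩ := hw.exists_multiples k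
  have hij : i = r ∧ j = r ∨ i = l ∧ j = m ∨ i = m ∧ j = l := by
    have sum_pairs : ∀ u a b : ZMod 5, u ≠ 0 → a ≠ 0 → b ≠ 0 → a + b = u →
        a = 3 * u ∧ b = 3 * u ∨ a = 4 * u ∧ b = 2 * u ∨ a = 2 * u ∧ b = 4 * u := by decide
    simpa only [← hr, ← hl, ← hm, hw.injective.eq_iff] using
      sum_pairs _ _ _ (hw.ne_zero k) (hw.ne_zero i) (hw.ne_zero j) hsum
  have label_cases : ∀ u r l m : ZMod 5, [u, r, l, m].Nodup → 0 ∉ [u, r, l, m] →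
      r + r = u ∨ l + m = u →
      r = 3 * u ∧ l = 4 * u ∧ m = 2 * u ∨ r + m = l ∧ m + m = r := by decide
  have hzero : 0 ∉ [k, r, l, m].map w' := fun h =>
    let ⟨n, _, hn⟩ := List.mem_map.1 h
    hw'.ne_zero n hn
  have hsum_or : w' r + w' r = w' k ∨ w' l + w' m = w' k := by
    obtain ⟨rfl, rfl⟩ | ⟨rfl, rfl⟩ | ⟨rfl, rfl⟩ := hij
    · exact .inl hsum'
    · exact .inr hsum'
    · exact .inr (by rwa [add_comm])
  obtain ⟨hr', hl', hm'⟩ | ⟨hrm, hmm⟩ :=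
    label_cases _ _ _ _ (hnodup.map hw'.injective) hzero hsum_or
  · rw [hk] at hr' hl' hm'
    refine .inl (funext fun n => ?_)
    have hn := hall n
    simp only [List.mem_cons, List.not_mem_nil, or_false] at hn
    obtain rfl | rfl | rfl | rfl := hn
    exacts [hk, hr'.trans hr.symm, hl'.trans hl.symm, hm'.trans hm.symm]
  · refine .inr ⟨r, l, m, ?_, hrm, hmm, hij⟩
    rw [hr, hl, hm, ← add_mul]
    rfl

end IsLabelling

/-! ### Bipartite codes -/

/-- A perfect code of the bipartite graph on two copies of `M` in which `x` in the first copy is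
adjacent to the four elements `x + e i` of the second copy; `P` and `Q` are the two parts of the
code. -/
structure IsBipartiteCode {M : Type*} [AddCommGroup M] (e : Fin 4 → M) (P Q : Set M) : Prop where
  left : ∀ x, ExactlyOne (x ∈ P) fun i => x + e i ∈ Q
  right : ∀ x, ExactlyOne (x ∈ Q) fun i => x - e i ∈ P

/-- The elements of `Q` at distance three from `x` are the ones predicted by the labelling `w`. -/
def IsLinearAround {M : Type*} [AddCommGroup M] (e : Fin 4 → M) (w : Fin 4 → ZMod 5) (Q : Set M)
    (x : M) : Prop :=
  ∀ i j k, w i + w j = w k → x + e i + e j - e k ∈ Q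

namespace IsBipartiteCode

variable {M : Type*} [AddCommGroup M] {e : Fin 4 → M} {P Q : Set M} {w : Fin 4 → ZMod 5}

lemma of_isLabelling {φ : M →+ ZMod 5} {c : ZMod 5} (hw : IsLabelling fun i => φ (e i) + c) :
    IsBipartiteCode e {x | φ x = 0} {x | φ x + c = 0} where
  left x := by simpa [add_assoc] using hw.exactlyOne_add_eq_zero (φ x)
  right x := by
    have hneg : IsLabelling fun i => -1 * (φ (e i) + c) :=
      hw.mul_left (neg_ne_zero.2 one_ne_zero)
    simpa [sub_eq_add_neg, add_right_comm] using hneg.exactlyOne_add_eq_zero (φ x + c)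

lemma neg (h : IsBipartiteCode e P Q) : IsBipartiteCode (-e) Q P where
  left x := by simpa [sub_eq_add_neg] using h.right x
  right x := by simpa using h.left x

lemma unique_add (h : IsBipartiteCode e P Q) {y z : M} {i j : Fin 4} (hy : y ∈ Q) (hz : z ∈ Q)
    (hyz : y + e i = z + e j) : i = j := by
  refine (h.left (y - e j)).unique ?_ (by simpa using hy)
  rwa [sub_add_eq_add_sub, hyz, add_sub_cancel_right]

lemma exists_isLinearAround (h : IsBipartiteCode e P Q) {x : M} (hx : x ∈ P) :
    ∃ w, IsLabelling w ∧ IsLinearAround e w Q x := by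
  refine exists_isLabelling_of_rel (B := fun i k j => x + e i + e k - e j ∈ Q)
    (fun i k j hQ => by rwa [add_right_comm]) (fun i j hij => ?_)
    (fun i k k' j hk hk' => (h.unique_add hk hk' (by abel : _ + e k' = _ + e k)).symm)
    (fun i k j j' hj hj' => h.unique_add hj hj' (by abel))
  obtain hP | ⟨k, hk⟩ := (h.left (x + e i - e j)).cover
  · exact absurd ((h.right (x + e i)).unique (by simpa using hx) hP) hij
  · refine ⟨k, ?_, by rwa [add_sub_right_comm]⟩
    rintro rfl
    exact (h.left x).disjoint hx i (by simpa using hk)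

lemma exists_isLinearAround_apply_eq (h : IsBipartiteCode e P Q) {x : M} (hx : x ∈ P)
    (k : Fin 4) {c : ZMod 5} (hc : c ≠ 0) :
    ∃ w, IsLabelling w ∧ w k = c ∧ IsLinearAround e w Q x := by
  obtain ⟨w, hw, hlin⟩ := h.exists_isLinearAround hx
  have hscale : c / w k ≠ 0 := div_ne_zero hc (hw.ne_zero k)
  exact ⟨_, hw.mul_left hscale, div_mul_cancel₀ c (hw.ne_zero k), fun i j k hsum =>
    hlin i j k (mul_left_cancel₀ hscale (by rw [mul_add, hsum]))⟩

lemma isLinearAround_neg (h : IsBipartiteCode e P Q) (hw : IsLabelling w) {x : M} (hx : x ∈ P)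
    (hlin : IsLinearAround e w Q x) {i j k : Fin 4} (hsum : w i + w j = w k) :
    IsLinearAround (-e) w P (x + e i + e j - e k) := by
  obtain ⟨w', hw', hk, hlin'⟩ :=
    h.neg.exists_isLinearAround_apply_eq (hlin i j k hsum) k (hw.ne_zero k)
  simp only [IsLinearAround, Pi.neg_apply] at hlin'
  have hsum' : w' i + w' j = w' k := by
    have hik : w' k - w' i ≠ 0 := sub_ne_zero.2 fun hki => by
      obtain rfl := hw'.injective hki
      exact hw.ne_zero j (by simpa using hsum)
    obtain ⟨m, hm⟩ := hw'.exists_eq hik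
    have hm' : w' i + w' m = w' k := by rw [hm, add_sub_cancel]
    have : m = j := h.neg.unique_add hx (hlin' i m k hm') (by simp only [Pi.neg_apply]; abel)
    rwa [← this]
  obtain rfl | ⟨r, l, m, hrl, hrm, hmm, hij⟩ := hw.eq_or_swap hw' hk hsum hsum'
  · exact hlin'
  · have hP : x + e r + e l - e m - e k ∈ P := by
      obtain ⟨rfl, rfl⟩ | ⟨rfl, rfl⟩ | ⟨rfl, rfl⟩ := hij
      · convert hlin' j m l hrm using 1; abel
      · convert hlin' j j r hmm using 1; abel
      · convert hlin' i i r hmm using 1; abel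
    -- the codewords `x + e r + e l - e m - e k` and `x + e r + e l - e m` are adjacent
    exact ((h.left _).disjoint hP k (by simpa using hlin r l m hrl)).elim

end IsBipartiteCode

lemma exists_addMonoidHom_of_isLabelling {N : Type*} [AddCommGroup N] {w : Fin 4 → ZMod 5}
    (hw : IsLabelling w) {f : Fin 4 → N} (hf : ∀ i j k, w i + w j = w k → f i + f j = f k) :
    ∃ ψ : ZMod 5 →+ N, ∀ i, ψ (w i) = f i := by
  obtain ⟨k, hk⟩ := hw.exists_eq one_ne_zero
  obtain ⟨r, l, m, hr, hl, hm, -, hall⟩ := hw.exists_multiples k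
  rw [hk] at hr hl hm
  have hfm : f m = 2 • f k := by
    rw [two_nsmul, hf k k m (by rw [hk, hm]; rfl)]
  have hfr : f r = 3 • f k := by
    rw [succ_nsmul, ← hfm, hf m k r (by rw [hk, hm, hr]; rfl)]
  have hfl : f l = 4 • f k := by
    rw [succ_nsmul, ← hfr, hf r k l (by rw [hk, hr, hl]; rfl)]
  have htorsion : 5 • f k = 0 := by
    refine add_right_cancel (b := f k) ?_
    calc 5 • f k + f k = 3 • f k + 3 • f k := by rw [← succ_nsmul, ← add_nsmul]
      _ = 0 + f k := by rw [zero_add, ← hfr, hf r r k (by rw [hr, hk]; rfl)]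
  let ψ : ZMod 5 →+ N :=
    ZMod.lift 5 ⟨zmultiplesHom N (f k), (natCast_zsmul (f k) 5).trans htorsion⟩
  have hψ : ∀ n : ℕ, ψ n = n • f k := fun n => by
    rw [← Int.cast_natCast n]
    exact (ZMod.lift_coe 5 _ _).trans (by simp)
  refine ⟨ψ, fun i => ?_⟩
  have hi := hall i
  simp only [List.mem_cons, List.not_mem_nil, or_false] at hi
  obtain rfl | rfl | rfl | rfl := hi
  · rw [hk]; exact (hψ 1).trans (one_nsmul _)
  · rw [hr, hfr]; exact hψ 3
  · rw [hl, hfl]; exact hψ 4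
  · rw [hm, hfm]; exact hψ 2

lemma sum_add_single_smul {ι M : Type*} [Fintype ι] [DecidableEq ι] [AddCommGroup M] (n : ι → ℤ)
    (k : ι) (c : ℤ) (f : ι → M) :
    ∑ i, (n + Pi.single k c : ι → ℤ) i • f i = ∑ i, n i • f i + c • f k := by
  simp [add_smul, Finset.sum_add_distrib, Pi.single_apply, ite_smul]

/-- The codewords in `P` around which the code is linear, with a fixed labelling `w`. -/
def linearPoints {M : Type*} [AddCommGroup M] (e : Fin 4 → M) (w : Fin 4 → ZMod 5) (P Q : Set M) :
    Set M :=
  {x ∈ P | IsLinearAround e w Q x}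

namespace IsBipartiteCode

open scoped Pointwise

variable {M : Type*} [AddCommGroup M] {e : Fin 4 → M} {P Q : Set M} {w : Fin 4 → ZMod 5}

lemma add_mem_linearPoints (h : IsBipartiteCode e P Q) (hw : IsLabelling w) {x : M}
    (hx : x ∈ linearPoints e w P Q) {i j k : Fin 4} (hsum : w i + w j = w k) :
    x + e i + e j - e k ∈ linearPoints (-e) w Q P :=
  ⟨hx.2 i j k hsum, h.isLinearAround_neg hw hx.1 hx.2 hsum⟩

lemma sub_mem_stabilizer_linearPoints (h : IsBipartiteCode e P Q) (hw : IsLabelling w)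
    {i j k i' j' k' : Fin 4} (hsum : w i + w j = w k) (hsum' : w i' + w j' = w k') :
    e i + e j - e k - (e i' + e j' - e k') ∈ AddAction.stabilizer M (linearPoints e w P Q) := by
  have translate : ∀ {i j k i' j' k' : Fin 4}, w i + w j = w k → w i' + w j' = w k' →
      ∀ x ∈ linearPoints e w P Q,
        (e i + e j - e k - (e i' + e j' - e k')) + x ∈ linearPoints e w P Q := by
    intro i j k i' j' k' hsum hsum' x hx
    have hmem := h.neg.add_mem_linearPoints hw (h.add_mem_linearPoints hw hx hsum) hsum'
    rw [neg_neg] at hmem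
    convert hmem using 1
    simp only [Pi.neg_apply]
    abel
  refine AddAction.mem_stabilizer_set.2 fun x => ⟨fun hx => ?_, translate hsum hsum' x⟩
  convert translate hsum' hsum _ hx using 1
  rw [vadd_eq_add]
  abel

/-- Modulo the periods of the linear points, each `e i` is the sum of a constant and of the value
at `w i` of a homomorphism, so linearity at `0` spreads to the whole sublattice. -/
lemma mem_linearPoints_of_weight_eq_zero (h : IsBipartiteCode e P Q) (hw : IsLabelling w)
    (h0 : 0 ∈ linearPoints e w P Q) {n : Fin 4 → ℤ} (hn : ∑ i, n i = 0)
    (hnw : ∑ i, n i • w i = 0) : ∑ i, n i • e i ∈ linearPoints e w P Q := by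
  let H := AddAction.stabilizer M (linearPoints e w P Q)
  obtain ⟨i₀, j₀, k₀, h₀⟩ : ∃ i₀ j₀ k₀, w i₀ + w j₀ = w k₀ := by
    obtain ⟨m, hm⟩ := hw.exists_eq (mul_ne_zero (by decide : (2 : ZMod 5) ≠ 0) (hw.ne_zero 0))
    exact ⟨0, 0, m, by rw [hm, two_mul]⟩
  let q := QuotientAddGroup.mk' H
  let τ := q (e i₀ + e j₀ - e k₀)
  obtain ⟨ψ, hψ⟩ := exists_addMonoidHom_of_isLabelling hw (f := fun i => q (e i) - τ)
    fun i j k hsum => by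
      have hτ : q (e i + e j - e k) = τ := QuotientAddGroup.eq_iff_sub_mem.2
        (h.sub_mem_stabilizer_linearPoints hw hsum h₀)
      rw [← hτ]
      simp only [map_add, map_sub]
      abel
  have hq : ∀ i, q (e i) = ψ (w i) + τ := fun i => by rw [hψ, sub_add_cancel]
  have hH : ∑ i, n i • e i ∈ H := by
    refine (QuotientAddGroup.eq_zero_iff _).1 (?_ : q _ = 0)
    simp only [map_sum, map_zsmul, hq, smul_add, Finset.sum_add_distrib, ← Finset.sum_smul, hn,
      zero_smul, add_zero]
    rw [← map_zero ψ, ← hnw, map_sum]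
    simp only [map_zsmul]
  simpa using (AddAction.mem_stabilizer_set.1 hH 0).2 h0

theorem exists_isLabelling_mem_iff (h : IsBipartiteCode e P Q) (h0 : 0 ∈ P) :
    ∃ w, IsLabelling w ∧ ∀ n : Fin 4 → ℤ,
      (∑ i, n i = 0 → (∑ i, n i • e i ∈ P ↔ ∑ i, n i • w i = 0)) ∧
      (∑ i, n i = 1 → (∑ i, n i • e i ∈ Q ↔ ∑ i, n i • w i = 0)) := by
  obtain ⟨w, hw, hlin⟩ := h.exists_isLinearAround h0
  have sum_add_single : ∀ (n : Fin 4 → ℤ) k c,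
      ∑ i, (n + Pi.single k c : Fin 4 → ℤ) i = ∑ i, n i + c := by
    simp [Finset.sum_add_distrib]
  have mem_left : ∀ n : Fin 4 → ℤ, ∑ i, n i = 0 → ∑ i, n i • w i = 0 →
      ∑ i, n i • e i ∈ linearPoints e w P Q :=
    fun n => h.mem_linearPoints_of_weight_eq_zero hw ⟨h0, hlin⟩
  have mem_right : ∀ n : Fin 4 → ℤ, ∑ i, n i = 1 → ∑ i, n i • w i = 0 → ∑ i, n i • e i ∈ Q := by
    intro n hn hnw
    obtain ⟨m, hm⟩ := hw.exists_eq (mul_ne_zero (by decide : (2 : ZMod 5) ≠ 0) (hw.ne_zero 0))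
    have hsum : w 0 + w 0 = w m := by rw [hm, two_mul]
    have hmem := (mem_left (n + Pi.single 0 (-2) + Pi.single m 1)
      (by rw [sum_add_single, sum_add_single, hn]; rfl)
      (by rw [sum_add_single_smul, sum_add_single_smul, hnw, ← hsum]; module)).2 0 0 m hsum
    rw [sum_add_single_smul, sum_add_single_smul] at hmem
    convert hmem using 1
    module
  refine ⟨w, hw, fun n => ⟨fun hn => ⟨fun hP => ?_, fun hnw => (mem_left n hn hnw).1⟩,
    fun hn => ⟨fun hQ => ?_, mem_right n hn⟩⟩⟩
  · by_contra hnw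
    obtain ⟨i, hi⟩ := hw.exists_eq (neg_ne_zero.2 hnw)
    have hQ := mem_right (n + Pi.single i 1) (by rw [sum_add_single, hn]; rfl)
      (by rw [sum_add_single_smul, hi]; module)
    rw [sum_add_single_smul, one_smul] at hQ
    exact (h.left _).disjoint hP i hQ
  · by_contra hnw
    obtain ⟨i, hi⟩ := hw.exists_eq hnw
    have hP := (mem_left (n + Pi.single i (-1)) (by rw [sum_add_single, hn]; rfl)
      (by rw [sum_add_single_smul, hi]; module)).1
    rw [sum_add_single_smul, neg_one_smul, ← sub_eq_add_neg] at hP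
    exact (h.right _).disjoint hQ i hP

end IsBipartiteCode

/-! ### Codes of the three-dimensional lattice and of the square grid -/

lemma isLabelling_iff_nodup {w : Fin 4 → ZMod 5} :
    IsLabelling w ↔ [0, w 0, w 1, w 2, w 3].Nodup := by
  have hlist : List.ofFn w = [w 0, w 1, w 2, w 3] := by simp [List.ofFn_succ]
  rw [← hlist, List.nodup_cons, List.nodup_ofFn, List.mem_ofFn]
  exact ⟨fun h => ⟨fun ⟨i, hi⟩ => h.ne_zero i hi, h.injective⟩,
    fun h => ⟨h.2, fun i hi => h.1 ⟨i, hi⟩⟩⟩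

lemma admissibleTriple_iff {v : ℕ} {a b : ℤ} :
    AdmissibleTriple v a b ↔
      (v = 2 ∧ (a = 1 ∧ b = 2 ∨ a = 2 ∧ b = 1)) ∨ (v = 3 ∧ (a = 1 ∧ b = 3 ∨ a = 3 ∧ b = 1)) ∨
        (v = 4 ∧ (a = 2 ∧ b = 3 ∨ a = 3 ∧ b = 2)) := by
  have p2 : parity 2 = 0 := by norm_num [parity]
  have p3 : parity 3 = 1 := by norm_num [parity]
  have p4 : parity 4 = 0 := by norm_num [parity]
  simp only [AdmissibleTriple, Set.mem_insert_iff, Set.mem_singleton_iff, Set.pair_eq_pair_iff]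
  constructor
  · rintro ⟨rfl | rfl | rfl, h⟩ <;> simp only [p2, p3, p4] at h <;> push_cast at h <;> omega
  · rintro (⟨rfl, h⟩ | ⟨rfl, h⟩ | ⟨rfl, h⟩) <;> simp only [p2, p3, p4] <;>
      refine ⟨by simp, ?_⟩ <;> push_cast <;> omega

/-- The labels that the linear code with parameters `v`, `a`, `b` gives to the directions `0`,
`(1, 0, 0)`, `(0, 1, 0)` and `(0, 0, 1)`. -/
def tripleLabels (v a b : ZMod 5) : Fin 4 → ZMod 5 :=
  ![-v, 1 - v, -a - v, -b - v]

lemma AdmissibleTriple.isLabelling {v : ℕ} {a b : ℤ} (h : AdmissibleTriple v a b) :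
    IsLabelling (tripleLabels v a b) := by
  rw [isLabelling_iff_nodup]
  obtain ⟨rfl, ⟨rfl, rfl⟩ | ⟨rfl, rfl⟩⟩ | ⟨rfl, ⟨rfl, rfl⟩ | ⟨rfl, rfl⟩⟩ |
    ⟨rfl, ⟨rfl, rfl⟩ | ⟨rfl, rfl⟩⟩ := admissibleTriple_iff.1 h <;> decide

lemma IsLabelling.admissibleTriple {v a b : ZMod 5} (h : IsLabelling (tripleLabels v a b)) :
    AdmissibleTriple v.val a.val b.val := by
  have key : ∀ v a b : ZMod 5, [0, -v, 1 - v, -a - v, -b - v].Nodup →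
      (v = 2 ∧ (a = 1 ∧ b = 2 ∨ a = 2 ∧ b = 1)) ∨ (v = 3 ∧ (a = 1 ∧ b = 3 ∨ a = 3 ∧ b = 1)) ∨
        (v = 4 ∧ (a = 2 ∧ b = 3 ∨ a = 3 ∧ b = 2)) := by decide
  rw [admissibleTriple_iff]
  obtain ⟨rfl, ⟨rfl, rfl⟩ | ⟨rfl, rfl⟩⟩ | ⟨rfl, ⟨rfl, rfl⟩ | ⟨rfl, rfl⟩⟩ |
    ⟨rfl, ⟨rfl, rfl⟩ | ⟨rfl, rfl⟩⟩ := key v a b (isLabelling_iff_nodup.1 h) <;> decide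

/-- The linear form modulo `5` whose fibres over `0` and `v` are the two parts of a linear code. -/
def codeForm (a b : ℤ) : ℤ × ℤ × ℤ →+ ZMod 5 where
  toFun x := x.1 - a * x.2.1 - b * x.2.2
  map_zero' := by simp
  map_add' x y := by
    simp only [Prod.fst_add, Prod.snd_add]
    push_cast
    ring

lemma codeForm_apply (a b : ℤ) (x : ℤ × ℤ × ℤ) :
    codeForm a b x = x.1 - a * x.2.1 - b * x.2.2 := rfl

/-- For `S = {t, t * s₀, t * s₁, t * s₂}`, the exponent vectors of the elements `t * s` with
`s ∈ S`. -/
def latticeStep : Fin 4 → ℤ × ℤ × ℤ := ![0, (1, 0, 0), (0, 1, 0), (0, 0, 1)]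

lemma sum_smul_latticeStep (n : Fin 4 → ℤ) : ∑ i, n i • latticeStep i = (n 1, n 2, n 3) := by
  simp [Fin.sum_univ_four, latticeStep, -zsmul_eq_mul]

lemma IsLabelling.exists_tripleLabels {w : Fin 4 → ZMod 5} (hw : IsLabelling w) :
    ∃ d ≠ 0, ∃ v a b, w = fun i => d * tripleLabels v a b i := by
  have hd : w 1 - w 0 ≠ 0 := sub_ne_zero.2 (hw.injective.ne (by decide))
  refine ⟨w 1 - w 0, hd, -(w 0 / (w 1 - w 0)), (w 0 - w 2) / (w 1 - w 0),
    (w 0 - w 3) / (w 1 - w 0), funext fun i => ?_⟩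
  fin_cases i <;> simp [tripleLabels] <;> field_simp <;> ring

lemma sum_smul_tripleLabels (n : Fin 4 → ℤ) (v a b : ZMod 5) :
    ∑ i, n i • tripleLabels v a b i = n 1 - a * n 2 - b * n 3 - (∑ i, n i : ℤ) * v := by
  simp only [tripleLabels, zsmul_eq_mul, Fin.sum_univ_four, Matrix.cons_val]
  push_cast
  ring

theorem isBipartiteCode_latticeStep_iff {P Q : Set (ℤ × ℤ × ℤ)} :
    IsBipartiteCode latticeStep P Q ∧ 0 ∈ P ↔ ∃ (v : ℕ) (a b : ℤ), AdmissibleTriple v a b ∧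
      ∀ x, (x ∈ P ↔ codeForm a b x = 0) ∧ (x ∈ Q ↔ codeForm a b x = v) := by
  constructor
  · rintro ⟨h, h0⟩
    obtain ⟨w, hw, hmem⟩ := h.exists_isLabelling_mem_iff h0
    obtain ⟨d, hd, v, a, b, rfl⟩ := hw.exists_tripleLabels
    have hlabels : IsLabelling (tripleLabels v a b) := by
      simpa only [inv_mul_cancel_left₀ hd] using hw.mul_left (inv_ne_zero hd)
    have weight_eq_zero : ∀ n : Fin 4 → ℤ, ∑ i, n i • (d * tripleLabels v a b i) = 0 ↔
        n 1 - a * n 2 - b * n 3 - (∑ i, n i : ℤ) * v = 0 := fun n => by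
      simp only [← mul_smul_comm, ← Finset.mul_sum, mul_eq_zero, hd, false_or,
        sum_smul_tripleLabels]
    refine ⟨v.val, a.val, b.val, hlabels.admissibleTriple, fun x => ⟨?_, ?_⟩⟩
    · have hn : ∑ i, ![-x.1 - x.2.1 - x.2.2, x.1, x.2.1, x.2.2] i = 0 := by
        simp only [Fin.sum_univ_four, Matrix.cons_val]
        ring
      have hP := (hmem _).1 hn
      rw [sum_smul_latticeStep, weight_eq_zero, hn] at hP
      simpa [codeForm_apply] using hP
    · have hn : ∑ i, ![1 - x.1 - x.2.1 - x.2.2, x.1, x.2.1, x.2.2] i = 1 := by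
        simp only [Fin.sum_univ_four, Matrix.cons_val]
        ring
      have hQ := (hmem _).2 hn
      rw [sum_smul_latticeStep, weight_eq_zero, hn] at hQ
      simpa [codeForm_apply, sub_eq_zero] using hQ
  · rintro ⟨v, a, b, hv, hPQ⟩
    have hcode : IsBipartiteCode latticeStep {x | codeForm a b x = 0}
        {x | codeForm a b x + -v = 0} := by
      refine .of_isLabelling ?_
      convert hv.isLabelling using 2 with i
      fin_cases i <;> simp [codeForm_apply, tripleLabels, latticeStep, sub_eq_add_neg]
    refine ⟨?_, (hPQ 0).1.2 (map_zero _)⟩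
    convert hcode using 1 <;> ext x
    exacts [(hPQ x).1, (hPQ x).2.trans (by simp [← sub_eq_add_neg, sub_eq_zero])]

/-- The four unit steps of the grid, in the order in which `s₁`, `s₁⁻¹`, `t`, `t * s₀` act on the
points with even first coordinate. -/
def gridStep : Fin 4 → ℤ × ℤ := ![(0, -1), (0, 1), (-1, 0), (1, 0)]

lemma sum_smul_gridStep (n : Fin 4 → ℤ) :
    ∑ i, n i • gridStep i = (n 3 - n 2, n 1 - n 0) := by
  simp only [gridStep, Fin.sum_univ_four, Matrix.cons_val, Prod.smul_mk, smul_eq_mul,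
    Prod.mk_add_mk]
  ext <;> ring

lemma IsBipartiteCode.exists_mem_iff_of_gridStep {R : Set (ℤ × ℤ)}
    (h : IsBipartiteCode gridStep R R) (h0 : 0 ∈ R) :
    ∃ ε ∈ ({1, -1} : Set ℤ), ∀ z, z ∈ R ↔ (z.1 - 2 * ε * z.2 : ZMod 5) = 0 := by
  obtain ⟨w, hw, hmem⟩ := h.exists_isLabelling_mem_iff h0
  simp only [sum_smul_gridStep] at hmem
  simp only [Fin.sum_univ_four, zsmul_eq_mul] at hmem
  have hrel : w 0 + w 1 = w 2 + w 3 := by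
    have hR := ((hmem ![1, 1, -1, -1]).1 rfl).1 (by simpa [Prod.zero_eq_mk] using h0)
    simp only [Matrix.cons_val, Int.cast_neg, Int.cast_one] at hR
    linear_combination hR
  have key : ∀ a b c d : ZMod 5, [0, a, b, c, d].Nodup → a + b = c + d →
      a + b = 0 ∧ (b = -2 * d ∨ b = 2 * d) := by decide
  obtain ⟨hopp, hw1⟩ := key _ _ _ _ (isLabelling_iff_nodup.1 hw) hrel
  have hR : ∀ z : ℤ × ℤ, z ∈ R ↔ (z.1 * w 3 + z.2 * w 1 : ZMod 5) = 0 := by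
    intro z
    have hweight : ∀ k : ℤ, (-(k * w 0) + (z.2 - k) * w 1 + z.1 * w 3 : ZMod 5) =
        z.1 * w 3 + z.2 * w 1 := fun k => by linear_combination -k * hopp
    obtain ⟨k, hk⟩ | ⟨k, hk⟩ := (z.1 + z.2).even_or_odd
    · simpa [hweight] using (hmem ![-k, z.2 - k, 0, z.1]).1 (by simp; lia)
    · simpa [hweight] using (hmem ![-k, z.2 - k, 0, z.1]).2 (by simp; lia)
  obtain ⟨ε, hε, hw1⟩ : ∃ ε ∈ ({1, -1} : Set ℤ), w 1 = -2 * ε * w 3 :=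
    hw1.elim (fun h => ⟨1, by simp, by simp [h]⟩) fun h => ⟨-1, by simp, by simp [h]⟩
  refine ⟨ε, hε, fun z => (hR z).trans ?_⟩
  have hfactor : (z.1 * w 3 + z.2 * w 1 : ZMod 5) = w 3 * (z.1 - 2 * ε * z.2) := by
    rw [hw1]
    ring
  rw [hfactor, mul_eq_zero, or_iff_right (hw.ne_zero 3)]

theorem isBipartiteCode_gridStep_iff {R : Set (ℤ × ℤ)} :
    IsBipartiteCode gridStep R R ∧ 0 ∈ R ↔
      ∃ ε ∈ ({1, -1} : Set ℤ), ∀ z, z ∈ R ↔ (z.1 - 2 * ε * z.2 : ZMod 5) = 0 := by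
  refine ⟨fun h => h.1.exists_mem_iff_of_gridStep h.2, ?_⟩
  rintro ⟨ε, hε, hR⟩
  let φ : ℤ × ℤ →+ ZMod 5 :=
    { toFun := fun z => z.1 - 2 * ε * z.2
      map_zero' := by simp
      map_add' := fun x y => by simp only [Prod.fst_add, Prod.snd_add]; push_cast; ring }
  have hlabels : IsLabelling fun i => φ (gridStep i) + 0 := by
    rw [isLabelling_iff_nodup]
    obtain rfl | rfl := hε <;> decide
  have hRφ : R = {z | φ z = 0} := Set.ext hR
  refine ⟨?_, (hR 0).2 (by simp)⟩
  have hcode := IsBipartiteCode.of_isLabelling hlabels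
  simp only [add_zero] at hcode
  rwa [hRφ]

/-! ### Relations in abelian groups -/

/-- The element with exponent vector `x` with respect to `s₀`, `s₁`, `s₂`. -/
def word {G : Type*} [Group G] (s₀ s₁ s₂ : G) (x : ℤ × ℤ × ℤ) : G :=
  s₀ ^ x.1 * s₁ ^ x.2.1 * s₂ ^ x.2.2

/-- Three pairwise commuting elements, so that `word` is a homomorphism. -/
structure IsCommutingTriple {G : Type*} [Group G] (s₀ s₁ s₂ : G) : Prop where
  commute₀₁ : Commute s₀ s₁
  commute₀₂ : Commute s₀ s₂
  commute₁₂ : Commute s₁ s₂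

section Words

variable {G : Type*} [Group G] {s₀ s₁ s₂ : G}

lemma word_zero : word s₀ s₁ s₂ 0 = 1 := by simp [word]

namespace IsCommutingTriple

lemma word_add (hs : IsCommutingTriple s₀ s₁ s₂) (x y : ℤ × ℤ × ℤ) :
    word s₀ s₁ s₂ (x + y) = word s₀ s₁ s₂ x * word s₀ s₁ s₂ y := by
  have h₁ : Commute (s₁ ^ x.2.1) (s₀ ^ y.1) := hs.commute₀₁.symm.zpow_zpow _ _
  have h₂ : Commute (s₂ ^ x.2.2) (s₀ ^ y.1 * s₁ ^ y.2.1) :=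
    (hs.commute₀₂.symm.zpow_zpow _ _).mul_right (hs.commute₁₂.symm.zpow_zpow _ _)
  simp only [word, Prod.fst_add, Prod.snd_add, zpow_add]
  rw [h₂.mul_mul_mul_comm, h₁.mul_mul_mul_comm]

/-- The lattice of relations between `s₀`, `s₁` and `s₂`. -/
def relations (hs : IsCommutingTriple s₀ s₁ s₂) : AddSubgroup (ℤ × ℤ × ℤ) where
  carrier := {x | word s₀ s₁ s₂ x = 1}
  zero_mem' := word_zero
  add_mem' hx hy := by
    rw [Set.mem_ofPred, hs.word_add, hx, hy, mul_one]
  neg_mem' {x} hx := by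
    have h := hs.word_add x (-x)
    rw [add_neg_cancel, word_zero, hx, one_mul] at h
    exact h.symm

lemma word_neg (hs : IsCommutingTriple s₀ s₁ s₂) (x : ℤ × ℤ × ℤ) :
    word s₀ s₁ s₂ (-x) = (word s₀ s₁ s₂ x)⁻¹ := by
  rw [eq_inv_iff_mul_eq_one, ← hs.word_add, neg_add_cancel, word_zero]

lemma mem_relations (hs : IsCommutingTriple s₀ s₁ s₂) {x : ℤ × ℤ × ℤ} :
    x ∈ hs.relations ↔ word s₀ s₁ s₂ x = 1 := Iff.rfl

lemma sub_mem_relations (hs : IsCommutingTriple s₀ s₁ s₂) {x y : ℤ × ℤ × ℤ} :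
    x - y ∈ hs.relations ↔ word s₀ s₁ s₂ x = word s₀ s₁ s₂ y := by
  rw [hs.mem_relations, sub_eq_add_neg, hs.word_add, hs.word_neg, mul_inv_eq_one]

lemma relations_le_ker_iff (hs : IsCommutingTriple s₀ s₁ s₂) {N : Type*} [AddCommGroup N]
    {φ : ℤ × ℤ × ℤ →+ N} : hs.relations ≤ φ.ker ↔
      ∀ x y, word s₀ s₁ s₂ x = word s₀ s₁ s₂ y → φ x = φ y := by
  refine ⟨fun h x y hxy => ?_, fun h x hx => ?_⟩
  · rw [← sub_eq_zero, ← map_sub]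
    exact h (hs.sub_mem_relations.2 hxy)
  · exact (h x 0 (hx.trans word_zero.symm)).trans (map_zero φ)

end IsCommutingTriple

section LeastExponent

variable {H : Subgroup G} {s : G} {m : ℕ}

lemma exists_mul_pow_eq_zpow (hm : IsLeast {i : ℕ | 0 < i ∧ s ^ i ∈ H} m) (k : ℤ) :
    ∃ r < m, ∃ h ∈ H, h * s ^ r = s ^ k := by
  have hpos : (0 : ℤ) < m := by exact_mod_cast hm.1.1
  have hlt := Int.emod_lt_of_pos k hpos
  have hdiv := Int.mul_ediv_add_emod k m
  lift k % m to ℕ using Int.emod_nonneg k hpos.ne' with r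
  refine ⟨r, by exact_mod_cast hlt, (s ^ m) ^ (k / m), zpow_mem hm.1.2 _, ?_⟩
  rw [← zpow_natCast, ← zpow_natCast, ← zpow_mul, ← zpow_add, hdiv]

lemma dvd_of_zpow_mem (hm : IsLeast {i : ℕ | 0 < i ∧ s ^ i ∈ H} m) {k : ℤ} (hk : s ^ k ∈ H) :
    (m : ℤ) ∣ k := by
  have hpos : (0 : ℤ) < m := by exact_mod_cast hm.1.1
  have hlt := Int.emod_lt_of_pos k hpos
  have hmem : s ^ (k % m) ∈ H := by
    rw [Int.emod_def, zpow_sub, zpow_mul, zpow_natCast]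
    exact mul_mem hk (inv_mem (zpow_mem hm.1.2 _))
  apply Int.dvd_of_emod_eq_zero
  lift k % m to ℕ using Int.emod_nonneg k hpos.ne' with r
  by_contra hr
  have := hm.2 ⟨Nat.pos_of_ne_zero (by exact_mod_cast hr), by simpa using hmem⟩
  omega

end LeastExponent

lemma exists_zpow_mul_zpow_of_mem_closure_pair (h : Commute s₀ s₁) {g : G}
    (hg : g ∈ Subgroup.closure {s₀, s₁}) : ∃ i j : ℤ, s₀ ^ i * s₁ ^ j = g := by
  have hs : IsCommutingTriple s₀ s₁ 1 := ⟨h, .one_right _, .one_right _⟩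
  suffices ∃ x, word s₀ s₁ 1 x = g by
    obtain ⟨x, rfl⟩ := this
    exact ⟨x.1, x.2.1, by simp [word]⟩
  induction hg using Subgroup.closure_induction with
  | mem x hx =>
    rcases hx with rfl | rfl
    · exact ⟨(1, 0, 0), by simp [word]⟩
    · exact ⟨(0, 1, 0), by simp [word]⟩
  | one => exact ⟨0, word_zero⟩
  | mul _ _ _ _ hx hy =>
    obtain ⟨x, rfl⟩ := hx
    obtain ⟨y, rfl⟩ := hy
    exact ⟨x + y, hs.word_add x y⟩
  | inv _ _ hx =>
    obtain ⟨x, rfl⟩ := hx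
    exact ⟨-x, hs.word_neg x⟩

lemma exists_zpow_mul_pow_of_mem_closure_pair (h : Commute s₀ s₁) {m : ℕ}
    (hm : IsLeast {i : ℕ | 0 < i ∧ s₁ ^ i ∈ Subgroup.zpowers s₀} m) {g : G}
    (hg : g ∈ Subgroup.closure {s₀, s₁}) : ∃ i : ℤ, ∃ j < m, s₀ ^ i * s₁ ^ j = g := by
  obtain ⟨i, j, rfl⟩ := exists_zpow_mul_zpow_of_mem_closure_pair h hg
  obtain ⟨r, hr, _, ⟨k, rfl⟩, hk⟩ := exists_mul_pow_eq_zpow hm j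
  refine ⟨i + k, r, hr, ?_⟩
  rw [zpow_add, mul_assoc, ← hk]

lemma exists_reduced_word (h : Commute s₀ s₁) {m l : ℕ}
    (hm : IsLeast {i : ℕ | 0 < i ∧ s₁ ^ i ∈ Subgroup.zpowers s₀} m)
    (hl : IsLeast {i : ℕ | 0 < i ∧ s₂ ^ i ∈ Subgroup.closure {s₀, s₁}} l) (x : ℤ × ℤ × ℤ) :
    ∃ i : ℤ, ∃ j < m, ∃ k < l, word s₀ s₁ s₂ (i, j, k) = word s₀ s₁ s₂ x := by
  obtain ⟨k, hk, g, hg, hgk⟩ := exists_mul_pow_eq_zpow hl x.2.2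
  have h₀ : s₀ ∈ Subgroup.closure {s₀, s₁} := Subgroup.subset_closure (by simp)
  have h₁ : s₁ ∈ Subgroup.closure {s₀, s₁} := Subgroup.subset_closure (by simp)
  obtain ⟨i, j, hj, hij⟩ := exists_zpow_mul_pow_of_mem_closure_pair h hm
    (mul_mem (mul_mem (zpow_mem h₀ x.1) (zpow_mem h₁ x.2.1)) hg)
  refine ⟨i, j, hj, k, hk, ?_⟩
  simp only [word, zpow_natCast, hij, ← hgk, mul_assoc]

lemma exists_zpow_eq {s : G} (hs : IsOfFinOrder s) (h5 : 5 ∣ orderOf s) {i r : ℤ}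
    (hi : (i : ZMod 5) = r) : ∃ w < orderOf s / 5, s ^ (5 * (w : ℤ) + r) = s ^ i := by
  obtain ⟨N, hN⟩ := h5
  obtain ⟨q, hq⟩ := (ZMod.intCast_eq_intCast_iff_dvd_sub r i 5).1 hi.symm
  have hpos : (0 : ℤ) < N := by have := hs.orderOf_pos; omega
  have hlt := Int.emod_lt_of_pos q hpos
  have hdiv := Int.mul_ediv_add_emod q N
  lift q % N to ℕ using Int.emod_nonneg q hpos.ne' with w
  refine ⟨w, by omega, ?_⟩
  rw [zpow_eq_zpow_iff_modEq, Int.modEq_iff_dvd, hN]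
  exact ⟨q / N, by push_cast at hq ⊢; linear_combination hq - 5 * hdiv⟩

namespace IsCommutingTriple

lemma relations_le_of_mem (hs : IsCommutingTriple s₀ s₁ s₂) {m l : ℕ}
    (hm : IsLeast {i : ℕ | 0 < i ∧ s₁ ^ i ∈ Subgroup.zpowers s₀} m)
    (hl : IsLeast {i : ℕ | 0 < i ∧ s₂ ^ i ∈ Subgroup.closure {s₀, s₁}} l) {i i' j : ℤ}
    (h₁ : (i, (m : ℤ), 0) ∈ hs.relations) (h₂ : (i', j, (l : ℤ)) ∈ hs.relations)
    {K : AddSubgroup (ℤ × ℤ × ℤ)} (hK₀ : ((orderOf s₀ : ℤ), 0, 0) ∈ K)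
    (hK₁ : (i, (m : ℤ), 0) ∈ K) (hK₂ : (i', j, (l : ℤ)) ∈ K) : hs.relations ≤ K := by
  have of_fst : ∀ a : ℤ, (a, 0, 0) ∈ hs.relations → (a, 0, 0) ∈ K := by
    intro a ha
    obtain ⟨q, rfl⟩ : (orderOf s₀ : ℤ) ∣ a :=
      orderOf_dvd_iff_zpow_eq_one.2 (by simpa [hs.mem_relations, word] using ha)
    simpa [mul_comm] using zsmul_mem hK₀ q
  have of_pair : ∀ a b : ℤ, (a, b, 0) ∈ hs.relations → (a, b, 0) ∈ K := by
    intro a b hab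
    obtain ⟨q, rfl⟩ : (m : ℤ) ∣ b := by
      have hab' : s₀ ^ a * s₁ ^ b = 1 := by simpa [hs.mem_relations, word] using hab
      refine dvd_of_zpow_mem hm ?_
      rw [eq_inv_of_mul_eq_one_right hab']
      exact inv_mem (zpow_mem (Subgroup.mem_zpowers s₀) _)
    have hfst := of_fst (a - q * i) (by
      convert sub_mem hab (zsmul_mem h₁ q) using 1
      ext <;> simp [mul_comm])
    simpa [mul_comm] using add_mem hfst (zsmul_mem hK₁ q)
  rintro ⟨a, b, c⟩ hx
  obtain ⟨q, rfl⟩ : (l : ℤ) ∣ c := by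
    refine dvd_of_zpow_mem hl ?_
    rw [eq_inv_of_mul_eq_one_right (hs.mem_relations.1 hx)]
    exact inv_mem (mul_mem (zpow_mem (Subgroup.subset_closure (by simp)) _)
      (zpow_mem (Subgroup.subset_closure (by simp)) _))
  have hpair := of_pair (a - q * i') (b - q * j) (by
    simpa [mul_comm] using sub_mem hx (zsmul_mem h₂ q))
  simpa [mul_comm] using add_mem hpair (zsmul_mem hK₂ q)

end IsCommutingTriple

end Words

/-! ### Generalized dihedral groups -/

section Dihedral

variable {G : Type*} [Group G] {A : Subgroup G} {t s₀ s₁ s₂ : G}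

namespace IsGeneralizedDihedral

lemma mul_self (hG : IsGeneralizedDihedral A t) : t * t = 1 := by
  simpa [hG.order_two, sq] using pow_orderOf_eq_one t

lemma t_mul (hG : IsGeneralizedDihedral A t) {x : G} (hx : x ∈ A) : t * x = x⁻¹ * t := by
  rw [← hG.conj x hx, mul_assoc, hG.mul_self, mul_one]

lemma isCommutingTriple (hG : IsGeneralizedDihedral A t) (h₀ : s₀ ∈ A) (h₁ : s₁ ∈ A)
    (h₂ : s₂ ∈ A) : IsCommutingTriple s₀ s₁ s₂ :=
  ⟨hG.comm _ h₀ _ h₁, hG.comm _ h₀ _ h₂, hG.comm _ h₁ _ h₂⟩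

end IsGeneralizedDihedral

lemma word_mem (h₀ : s₀ ∈ A) (h₁ : s₁ ∈ A) (h₂ : s₂ ∈ A) (x : ℤ × ℤ × ℤ) :
    word s₀ s₁ s₂ x ∈ A :=
  mul_mem (mul_mem (zpow_mem h₀ _) (zpow_mem h₁ _)) (zpow_mem h₂ _)

namespace IsGeneralizedDihedral

lemma t_mul_word (hG : IsGeneralizedDihedral A t) (h₀ : s₀ ∈ A) (h₁ : s₁ ∈ A) (h₂ : s₂ ∈ A)
    (x : ℤ × ℤ × ℤ) : t * word s₀ s₁ s₂ x = word s₀ s₁ s₂ (-x) * t := by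
  rw [hG.t_mul (word_mem h₀ h₁ h₂ x), (hG.isCommutingTriple h₀ h₁ h₂).word_neg]

lemma word_mul_t_ne_word (hG : IsGeneralizedDihedral A t) (h₀ : s₀ ∈ A) (h₁ : s₁ ∈ A)
    (h₂ : s₂ ∈ A) (x y : ℤ × ℤ × ℤ) : word s₀ s₁ s₂ x * t ≠ word s₀ s₁ s₂ y := fun h =>
  hG.notMem ((mul_mem_cancel_left (word_mem h₀ h₁ h₂ x)).1 (h ▸ word_mem h₀ h₁ h₂ y))

end IsGeneralizedDihedral

end Dihedral

section CodeTwo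

variable {G : Type*} [Group G] {A : Subgroup G} {t s₀ s₁ s₂ : G} {m l : ℕ} {a b : ℤ}

theorem IsCommutingTriple.conditionTwo_iff (hs : IsCommutingTriple s₀ s₁ s₂)
    (hs₀ : IsOfFinOrder s₀) (hm : IsLeast {i : ℕ | 0 < i ∧ s₁ ^ i ∈ Subgroup.zpowers s₀} m)
    (hl : IsLeast {i : ℕ | 0 < i ∧ s₂ ^ i ∈ Subgroup.closure {s₀, s₁}} l) :
    ConditionTwo s₀ s₁ s₂ m l a b ↔ hs.relations ≤ (codeForm a b).ker := by
  constructor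
  · rintro ⟨h5, α₁, -, α₂, -, j, -, h₁, h₂⟩
    have h5' : ((orderOf s₀ : ℕ) : ZMod 5) = 0 := (ZMod.natCast_eq_zero_iff _ 5).2 h5
    have five : (5 : ZMod 5) = 0 := rfl
    have r₁ := (hs.sub_mem_relations (x := (0, (m : ℤ), 0))
      (y := (5 * α₁ - a * m, 0, 0))).2 (by simp [word, h₁])
    have r₂ := (hs.sub_mem_relations (x := (0, 0, (l : ℤ)))
      (y := (5 * α₂ - b * l + a * j, (j : ℤ), 0))).2 (by simp [word, h₂])
    simp only [Prod.mk_sub_mk, sub_zero] at r₁ r₂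
    refine hs.relations_le_of_mem hm hl r₁ r₂ ?_ ?_ ?_ <;>
      simp [AddMonoidHom.mem_ker, codeForm_apply, h5', five]
  · intro h
    have congr := hs.relations_le_ker_iff.1 h
    have h5 : 5 ∣ orderOf s₀ := by
      simpa [codeForm_apply, ZMod.natCast_eq_zero_iff] using
        congr ((orderOf s₀ : ℤ), 0, 0) 0 (by simp [word, pow_orderOf_eq_one])
    obtain ⟨i, hi⟩ := Subgroup.mem_zpowers_iff.1 hm.1.2
    obtain ⟨i', j, hj, hij⟩ := exists_zpow_mul_pow_of_mem_closure_pair hs.commute₀₁ hm hl.1.2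
    have e₁ := congr (i, 0, 0) (0, (m : ℤ), 0) (by simp [word, hi])
    have e₂ := congr (i', (j : ℤ), 0) (0, 0, (l : ℤ)) (by simp [word, hij])
    simp only [codeForm_apply] at e₁ e₂
    push_cast at e₁ e₂
    obtain ⟨α₁, hα₁, hw₁⟩ := exists_zpow_eq hs₀ h5 (i := i) (r := -(a * m))
      (by push_cast; linear_combination e₁)
    obtain ⟨α₂, hα₂, hw₂⟩ := exists_zpow_eq hs₀ h5 (i := i') (r := -(b * l) + a * j)
      (by push_cast; linear_combination e₂)
    refine ⟨h5, α₁, hα₁, α₂, hα₂, j, hj, ?_, ?_⟩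
    · rw [← hi, ← hw₁, sub_eq_add_neg]
    · rw [← hij, ← hw₂, sub_eq_add_neg, add_assoc]

lemma IsCommutingTriple.exists_word_eq_iff (hs : IsCommutingTriple s₀ s₁ s₂)
    (hs₀ : IsOfFinOrder s₀) (hm : IsLeast {i : ℕ | 0 < i ∧ s₁ ^ i ∈ Subgroup.zpowers s₀} m)
    (hl : IsLeast {i : ℕ | 0 < i ∧ s₂ ^ i ∈ Subgroup.closure {s₀, s₁}} l)
    (h : ConditionTwo s₀ s₁ s₂ m l a b) (r : ℤ) (x : ℤ × ℤ × ℤ) :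
    (∃ α < orderOf s₀ / 5, ∃ j < m, ∃ k < l,
      word s₀ s₁ s₂ (5 * (α : ℤ) + a * j + b * k + r, (j : ℤ), (k : ℤ)) = word s₀ s₁ s₂ x) ↔
      codeForm a b x = r := by
  have congr := hs.relations_le_ker_iff.1 ((hs.conditionTwo_iff hs₀ hm hl).1 h)
  have five : (5 : ZMod 5) = 0 := rfl
  constructor
  · rintro ⟨α, -, j, -, k, -, hx⟩
    rw [← congr _ _ hx, codeForm_apply]
    push_cast
    linear_combination five * α
  · intro hx
    obtain ⟨i, j, hj, k, hk, hi⟩ := exists_reduced_word hs.commute₀₁ hm hl x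
    have e := (congr _ _ hi).trans hx
    simp only [codeForm_apply] at e
    push_cast at e
    obtain ⟨α, hα, hw⟩ := exists_zpow_eq hs₀ h.1 (i := i) (r := a * j + b * k + r)
      (by push_cast; linear_combination e)
    refine ⟨α, hα, j, hj, k, hk, ?_⟩
    rw [← hi, word, word, ← hw]
    ring_nf

lemma mem_codeTwo {v : ℕ} {g : G} :
    g ∈ codeTwo t s₀ s₁ s₂ m l v a b ↔
      (∃ α < orderOf s₀ / 5, ∃ j < m, ∃ k < l,
        word s₀ s₁ s₂ (5 * (α : ℤ) + a * j + b * k + (0 : ℤ), (j : ℤ), (k : ℤ)) * t = g) ∨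
      ∃ α < orderOf s₀ / 5, ∃ j < m, ∃ k < l,
        word s₀ s₁ s₂ (5 * (α : ℤ) + a * j + b * k + (v : ℤ), (j : ℤ), (k : ℤ)) = g := by
  simp only [codeTwo, Set.mem_iUnion, Finset.mem_range, exists_prop, Set.mem_union,
    Set.mem_singleton_iff, eq_comm (a := g), word, zpow_natCast, add_zero, and_or_left, exists_or]

lemma IsGeneralizedDihedral.mem_codeTwo_iff (hG : IsGeneralizedDihedral A t)
    (h₀ : s₀ ∈ A) (h₁ : s₁ ∈ A) (h₂ : s₂ ∈ A) (hs₀ : IsOfFinOrder s₀)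
    (hm : IsLeast {i : ℕ | 0 < i ∧ s₁ ^ i ∈ Subgroup.zpowers s₀} m)
    (hl : IsLeast {i : ℕ | 0 < i ∧ s₂ ^ i ∈ Subgroup.closure {s₀, s₁}} l)
    (h : ConditionTwo s₀ s₁ s₂ m l a b) {v : ℕ} (x : ℤ × ℤ × ℤ) :
    (word s₀ s₁ s₂ x * t ∈ codeTwo t s₀ s₁ s₂ m l v a b ↔ codeForm a b x = 0) ∧
      (word s₀ s₁ s₂ x ∈ codeTwo t s₀ s₁ s₂ m l v a b ↔ codeForm a b x = v) := by
  have hword := (hG.isCommutingTriple h₀ h₁ h₂).exists_word_eq_iff hs₀ hm hl h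
  have hne := hG.word_mul_t_ne_word h₀ h₁ h₂
  constructor
  · simpa only [mem_codeTwo, mul_left_inj, (hne _ _).symm, and_false, exists_false, or_false,
      Int.cast_zero] using hword 0 x
  · simpa only [mem_codeTwo, hne, and_false, exists_false, false_or, Int.cast_natCast] using
      hword v x

theorem IsGeneralizedDihedral.eq_codeTwo_iff (hG : IsGeneralizedDihedral A t)
    (h₀ : s₀ ∈ A) (h₁ : s₁ ∈ A) (h₂ : s₂ ∈ A) (hs₀ : IsOfFinOrder s₀)
    (hm : IsLeast {i : ℕ | 0 < i ∧ s₁ ^ i ∈ Subgroup.zpowers s₀} m)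
    (hl : IsLeast {i : ℕ | 0 < i ∧ s₂ ^ i ∈ Subgroup.closure {s₀, s₁}} l)
    (hgen : ∀ g, ∃ x, word s₀ s₁ s₂ x = g ∨ word s₀ s₁ s₂ x * t = g) {v : ℕ} {D : Set G} :
    (∀ x, (word s₀ s₁ s₂ x * t ∈ D ↔ codeForm a b x = 0) ∧
      (word s₀ s₁ s₂ x ∈ D ↔ codeForm a b x = v)) ↔
      ConditionTwo s₀ s₁ s₂ m l a b ∧ D = codeTwo t s₀ s₁ s₂ m l v a b := by
  have hs := hG.isCommutingTriple h₀ h₁ h₂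
  have hmem (h : ConditionTwo s₀ s₁ s₂ m l a b) :=
    hG.mem_codeTwo_iff h₀ h₁ h₂ hs₀ hm hl h (v := v)
  constructor
  · intro hD
    have hcond : ConditionTwo s₀ s₁ s₂ m l a b := by
      refine (hs.conditionTwo_iff hs₀ hm hl).2 fun x hx => (hD x).1.1 ?_
      rw [hs.mem_relations.1 hx, ← word_zero (s₀ := s₀) (s₁ := s₁) (s₂ := s₂)]
      exact (hD 0).1.2 (map_zero _)
    refine ⟨hcond, Set.ext fun g => ?_⟩
    obtain ⟨x, rfl | rfl⟩ := hgen g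
    · exact (hD x).2.trans (hmem hcond x).2.symm
    · exact (hD x).1.trans (hmem hcond x).1.symm
  · rintro ⟨hcond, rfl⟩
    exact hmem hcond

end CodeTwo

section CayleyGraph

variable {G : Type*} [Group G] {S : Set G}

lemma mulCayley_adj_iff (hone : (1 : G) ∉ S) (hinv : ∀ s ∈ S, s⁻¹ ∈ S) {x y : G} :
    (SimpleGraph.mulCayley S).Adj y x ↔ ∃ s ∈ S, x * s = y := by
  rw [SimpleGraph.mulCayley_adj]
  constructor
  · rintro ⟨-, h | h⟩
    · exact ⟨_, hinv _ h, by group⟩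
    · exact ⟨_, h, by group⟩
  · rintro ⟨s, hs, rfl⟩
    exact ⟨fun h => hone (mul_eq_left.1 h ▸ hs), .inr (by simpa using hs)⟩

lemma isPerfectCode_mulCayley_range_iff {ι : Type*} {c : ι → G} (hc : Injective c)
    (hone : (1 : G) ∉ Set.range c) (hinv : ∀ s ∈ Set.range c, s⁻¹ ∈ Set.range c) {D : Set G} :
    IsPerfectCode (SimpleGraph.mulCayley (Set.range c)) D ↔
      ∀ x, ExactlyOne (x ∈ D) fun i => x * c i ∈ D := by
  refine forall_congr' fun x => ?_
  let closedNeighbour : Option ι → G := fun o => o.elim x fun i => x * c i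
  have hinj : Injective closedNeighbour := by
    refine Option.injective_iff.2 ⟨(mul_right_injective x).comp hc, ?_⟩
    rintro ⟨i, hi⟩
    exact hone ⟨i, mul_eq_left.1 hi⟩
  have hrange : ∀ y, (y = x ∨ (SimpleGraph.mulCayley (Set.range c)).Adj y x) ↔
      y ∈ Set.range closedNeighbour := fun y => by
    simp [mulCayley_adj_iff hone hinv, Option.exists, closedNeighbour, eq_comm]
  have hmem : ∀ o : Option ι, closedNeighbour o ∈ D ↔ o.elim (x ∈ D) fun i => x * c i ∈ D :=
    fun o => by cases o <;> rfl
  simp only [hrange, ExactlyOne, ← hmem]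
  constructor
  · rintro ⟨_, ⟨hD, o, rfl⟩, huniq⟩
    exact ⟨o, hD, fun o' ho' => hinj (huniq _ ⟨ho', o', rfl⟩)⟩
  · rintro ⟨o, hD, huniq⟩
    refine ⟨_, ⟨hD, o, rfl⟩, ?_⟩
    rintro _ ⟨hD', o', rfl⟩
    rw [huniq o' hD']

namespace IsQuarticConnectionSet

lemma induction (hS : IsQuarticConnectionSet S) {p : G → Prop} (one : p 1)
    (mul : ∀ x, p x → ∀ s ∈ S, p (x * s)) (x : G) : p x := by
  have hx := (SimpleGraph.reachable_iff_reflTransGen _ _).1 (hS.connected.preconnected 1 x)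
  induction hx with
  | refl => exact one
  | tail _ hadj ih =>
    obtain ⟨s, hs, rfl⟩ := (mulCayley_adj_iff hS.one_notMem hS.inv_mem).1 hadj.symm
    exact mul _ ih s hs

lemma isPerfectCode_iff {c : Fin 4 → G} (hS : IsQuarticConnectionSet (Set.range c)) {D : Set G} :
    IsPerfectCode (SimpleGraph.mulCayley (Set.range c)) D ↔
      ∀ x, ExactlyOne (x ∈ D) fun i => x * c i ∈ D := by
  refine isPerfectCode_mulCayley_range_iff ?_ hS.one_notMem hS.inv_mem
  refine Set.injOn_univ.1 (Set.injOn_of_ncard_image_eq ?_)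
  simpa using hS.card_four

end IsQuarticConnectionSet

end CayleyGraph

section Lattice

variable {G : Type*} [Group G] {A : Subgroup G} {t s₀ s₁ s₂ : G}

namespace IsGeneralizedDihedral

lemma word_mul_t_mul_word (hG : IsGeneralizedDihedral A t) (h₀ : s₀ ∈ A) (h₁ : s₁ ∈ A)
    (h₂ : s₂ ∈ A) (x y : ℤ × ℤ × ℤ) :
    word s₀ s₁ s₂ x * t * word s₀ s₁ s₂ y = word s₀ s₁ s₂ (x - y) * t := by
  rw [mul_assoc, hG.t_mul_word h₀ h₁ h₂, ← mul_assoc, ← (hG.isCommutingTriple h₀ h₁ h₂).word_add,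
    sub_eq_add_neg]

lemma word_mul_t_mul_t_mul_word (hG : IsGeneralizedDihedral A t) (h₀ : s₀ ∈ A) (h₁ : s₁ ∈ A)
    (h₂ : s₂ ∈ A) (x y : ℤ × ℤ × ℤ) :
    word s₀ s₁ s₂ x * t * (t * word s₀ s₁ s₂ y) = word s₀ s₁ s₂ (x + y) := by
  rw [mul_assoc, ← mul_assoc t, hG.mul_self, one_mul, (hG.isCommutingTriple h₀ h₁ h₂).word_add]

lemma exists_word_eq_of_latticeStep (hG : IsGeneralizedDihedral A t) (h₀ : s₀ ∈ A)
    (h₁ : s₁ ∈ A) (h₂ : s₂ ∈ A)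
    (hS : IsQuarticConnectionSet (Set.range fun i => t * word s₀ s₁ s₂ (latticeStep i))) (g : G) :
    ∃ x, word s₀ s₁ s₂ x = g ∨ word s₀ s₁ s₂ x * t = g := by
  induction g using hS.induction with
  | one => exact ⟨0, .inl word_zero⟩
  | mul _ ih _ hs =>
    obtain ⟨i, rfl⟩ := hs
    obtain ⟨x, rfl | rfl⟩ := ih
    · exact ⟨_, .inr <| (hG.word_mul_t_mul_word h₀ h₁ h₂ x _).symm.trans (mul_assoc _ _ _)⟩
    · exact ⟨_, .inl (hG.word_mul_t_mul_t_mul_word h₀ h₁ h₂ x _).symm⟩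

lemma isPerfectCode_iff_isBipartiteCode_latticeStep (hG : IsGeneralizedDihedral A t)
    (h₀ : s₀ ∈ A) (h₁ : s₁ ∈ A) (h₂ : s₂ ∈ A)
    (hS : IsQuarticConnectionSet (Set.range fun i => t * word s₀ s₁ s₂ (latticeStep i)))
    {D : Set G} :
    IsPerfectCode (SimpleGraph.mulCayley (Set.range fun i => t * word s₀ s₁ s₂ (latticeStep i))) D ↔
      IsBipartiteCode latticeStep {x | word s₀ s₁ s₂ x * t ∈ D} {x | word s₀ s₁ s₂ x ∈ D} := by
  have hleft := hG.word_mul_t_mul_t_mul_word h₀ h₁ h₂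
  have hright (x y) := (mul_assoc _ _ _).symm.trans (hG.word_mul_t_mul_word h₀ h₁ h₂ x y)
  rw [hS.isPerfectCode_iff]
  constructor
  · intro h
    exact ⟨fun x => by simpa only [Set.mem_ofPred_eq, hleft] using h (word s₀ s₁ s₂ x * t),
      fun x => by simpa only [Set.mem_ofPred_eq, hright] using h (word s₀ s₁ s₂ x)⟩
  · intro h g
    obtain ⟨x, rfl | rfl⟩ := hG.exists_word_eq_of_latticeStep h₀ h₁ h₂ hS g
    · simpa only [Set.mem_ofPred_eq, hright] using h.right x
    · simpa only [Set.mem_ofPred_eq, hleft] using h.left x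

theorem isPerfectCode_iff_eq_codeTwo (hG : IsGeneralizedDihedral A t)
    (h₀ : s₀ ∈ A) (h₁ : s₁ ∈ A) (h₂ : s₂ ∈ A) (hs₀ : IsOfFinOrder s₀)
    (hS : IsQuarticConnectionSet {t, t * s₀, t * s₁, t * s₂}) {m l : ℕ}
    (hm : IsLeast {i : ℕ | 0 < i ∧ s₁ ^ i ∈ Subgroup.zpowers s₀} m)
    (hl : IsLeast {i : ℕ | 0 < i ∧ s₂ ^ i ∈ Subgroup.closure {s₀, s₁}} l) {D : Set G} :
    (IsPerfectCode (SimpleGraph.mulCayley {t, t * s₀, t * s₁, t * s₂}) D ∧ t ∈ D) ↔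
      ∃ (v : ℕ) (a b : ℤ), AdmissibleTriple v a b ∧ ConditionTwo s₀ s₁ s₂ m l a b ∧
        D = codeTwo t s₀ s₁ s₂ m l v a b := by
  have hrange : ({t, t * s₀, t * s₁, t * s₂} : Set G) =
      Set.range fun i => t * word s₀ s₁ s₂ (latticeStep i) := by
    ext
    simp [Fin.exists_fin_succ, latticeStep, word, eq_comm]
  rw [hrange] at hS ⊢
  have ht : t ∈ D ↔ 0 ∈ {x | word s₀ s₁ s₂ x * t ∈ D} := by simp [word_zero]
  rw [hG.isPerfectCode_iff_isBipartiteCode_latticeStep h₀ h₁ h₂ hS, ht,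
    isBipartiteCode_latticeStep_iff]
  have hgen := hG.exists_word_eq_of_latticeStep h₀ h₁ h₂ hS
  simp only [Set.mem_ofPred_eq, hG.eq_codeTwo_iff h₀ h₁ h₂ hs₀ hm hl hgen]

end IsGeneralizedDihedral

end Lattice

section Grid

variable {G : Type*} [Group G] {A : Subgroup G} {t s₀ s₁ : G}

lemma exactlyOne_sub_gridStep_iff {p : Prop} {R : Set (ℤ × ℤ)} {z : ℤ × ℤ} :
    (ExactlyOne p fun i => z - gridStep i ∈ R) ↔ ExactlyOne p fun i => z + gridStep i ∈ R := by
  have hneg : ∀ i, gridStep ((Equiv.swap 0 1 * Equiv.swap 2 3 : Equiv.Perm (Fin 4)) i) =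
    -gridStep i := by decide
  rw [← ExactlyOne.comp_equiv_iff (Equiv.swap 0 1 * Equiv.swap 2 3 : Equiv.Perm (Fin 4))]
  simp only [hneg, sub_neg_eq_add]

/-- The Cayley graph with connection set `{s₁, s₁⁻¹, t, t * s₀}` as a quotient of the square grid:
`s₀ ^ i * s₁ ^ q * t` sits at `(2 * i, q)` and `s₀ ^ i * s₁ ^ q` at `(2 * i - 1, q)`. -/
def gridPoint (t s₀ s₁ : G) (z : ℤ × ℤ) : G :=
  if Even z.1 then word s₀ s₁ 1 (z.1 / 2, z.2, 0) * t else word s₀ s₁ 1 ((z.1 + 1) / 2, z.2, 0)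

lemma gridPoint_two_mul (i q : ℤ) :
    gridPoint t s₀ s₁ (2 * i, q) = word s₀ s₁ 1 (i, q, 0) * t := by
  simp [gridPoint]

lemma gridPoint_two_mul_sub_one (i q : ℤ) :
    gridPoint t s₀ s₁ (2 * i - 1, q) = word s₀ s₁ 1 (i, q, 0) := by
  simp [gridPoint]

/-- The generators in the order of `gridStep`. -/
def gridGenerator (t s₀ s₁ : G) : Fin 4 → G := ![s₁, s₁⁻¹, t, t * s₀]

namespace IsGeneralizedDihedral

lemma gridPoint_mul_of_even (hG : IsGeneralizedDihedral A t) (h₀ : s₀ ∈ A) (h₁ : s₁ ∈ A)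
    {z : ℤ × ℤ} (hz : Even z.1) (k : Fin 4) :
    gridPoint t s₀ s₁ z * gridGenerator t s₀ s₁ k = gridPoint t s₀ s₁ (z + gridStep k) := by
  have hright := hG.word_mul_t_mul_word h₀ h₁ (one_mem A)
  have hleft := hG.word_mul_t_mul_t_mul_word h₀ h₁ (one_mem A)
  obtain ⟨p, q⟩ := z
  obtain ⟨i, rfl⟩ := hz.two_dvd
  have hprev : gridPoint t s₀ s₁ (2 * i + -1, q) = word s₀ s₁ 1 (i, q, 0) :=
    gridPoint_two_mul_sub_one i q
  have hnext : gridPoint t s₀ s₁ (2 * i + 1, q) = word s₀ s₁ 1 (i + 1, q, 0) := by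
    rw [← gridPoint_two_mul_sub_one (t := t)]
    ring_nf
  fin_cases k
  · simpa [gridPoint_two_mul, gridGenerator, gridStep, word, sub_eq_add_neg] using
      hright (i, q, 0) (0, 1, 0)
  · simpa [gridPoint_two_mul, gridGenerator, gridStep, word] using hright (i, q, 0) (0, -1, 0)
  · simpa [gridPoint_two_mul, hprev, gridGenerator, gridStep, word] using hleft (i, q, 0) 0
  · simpa [gridPoint_two_mul, hnext, gridGenerator, gridStep, word] using hleft (i, q, 0) (1, 0, 0)

lemma gridPoint_mul_of_odd (hG : IsGeneralizedDihedral A t) (h₀ : s₀ ∈ A) (h₁ : s₁ ∈ A)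
    {z : ℤ × ℤ} (hz : Odd z.1) (k : Fin 4) :
    gridPoint t s₀ s₁ z * gridGenerator t s₀ s₁ k = gridPoint t s₀ s₁ (z - gridStep k) := by
  have hadd := (hG.isCommutingTriple h₀ h₁ (one_mem A)).word_add
  have hright (x y) := (mul_assoc _ _ _).symm.trans
    (hG.word_mul_t_mul_word h₀ h₁ (one_mem A) x y)
  obtain ⟨p, q⟩ := z
  obtain ⟨i, rfl⟩ : ∃ i, p = 2 * i - 1 := by
    obtain ⟨j, rfl⟩ := hz
    exact ⟨j + 1, by ring⟩
  have hprev : gridPoint t s₀ s₁ (2 * i - 1 - 1, q) = word s₀ s₁ 1 (i - 1, q, 0) * t := by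
    rw [← gridPoint_two_mul]
    ring_nf
  fin_cases k
  · simpa [gridPoint_two_mul_sub_one, gridGenerator, gridStep, word] using
      (hadd (i, q, 0) (0, 1, 0)).symm
  · simpa [gridPoint_two_mul_sub_one, gridGenerator, gridStep, word, ← sub_eq_add_neg] using
      (hadd (i, q, 0) (0, -1, 0)).symm
  · simp [gridPoint_two_mul_sub_one, gridPoint_two_mul, gridGenerator, gridStep, word]
  · simpa [gridPoint_two_mul_sub_one, hprev, gridGenerator, gridStep, word] using
      hright (i, q, 0) (1, 0, 0)

lemma gridPoint_surjective (hG : IsGeneralizedDihedral A t) (h₀ : s₀ ∈ A) (h₁ : s₁ ∈ A)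
    (hS : IsQuarticConnectionSet (Set.range (gridGenerator t s₀ s₁))) :
    Surjective (gridPoint t s₀ s₁) := by
  intro g
  induction g using hS.induction with
  | one => exact ⟨(-1, 0), by simpa [word] using gridPoint_two_mul_sub_one 0 0⟩
  | mul _ ih _ hs =>
    obtain ⟨k, rfl⟩ := hs
    obtain ⟨z, rfl⟩ := ih
    obtain hz | hz := z.1.even_or_odd
    · exact ⟨_, (hG.gridPoint_mul_of_even h₀ h₁ hz k).symm⟩
    · exact ⟨_, (hG.gridPoint_mul_of_odd h₀ h₁ hz k).symm⟩

lemma isPerfectCode_iff_isBipartiteCode_gridStep (hG : IsGeneralizedDihedral A t)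
    (h₀ : s₀ ∈ A) (h₁ : s₁ ∈ A)
    (hS : IsQuarticConnectionSet (Set.range (gridGenerator t s₀ s₁))) {D : Set G} :
    IsPerfectCode (SimpleGraph.mulCayley (Set.range (gridGenerator t s₀ s₁))) D ↔
      IsBipartiteCode gridStep (gridPoint t s₀ s₁ ⁻¹' D) (gridPoint t s₀ s₁ ⁻¹' D) := by
  have hpoint : ∀ z, (ExactlyOne (gridPoint t s₀ s₁ z ∈ D) fun k =>
      gridPoint t s₀ s₁ z * gridGenerator t s₀ s₁ k ∈ D) ↔
      ExactlyOne (z ∈ gridPoint t s₀ s₁ ⁻¹' D)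
        fun k => z + gridStep k ∈ gridPoint t s₀ s₁ ⁻¹' D := by
    intro z
    obtain hz | hz := z.1.even_or_odd
    · simp only [hG.gridPoint_mul_of_even h₀ h₁ hz, Set.mem_preimage]
    · rw [← exactlyOne_sub_gridStep_iff]
      simp only [hG.gridPoint_mul_of_odd h₀ h₁ hz, Set.mem_preimage]
  rw [hS.isPerfectCode_iff, (hG.gridPoint_surjective h₀ h₁ hS).forall]
  simp only [hpoint]
  exact ⟨fun h => ⟨h, fun z => exactlyOne_sub_gridStep_iff.2 (h z)⟩, fun h => h.left⟩

end IsGeneralizedDihedral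

lemma forall_gridPoint_mem_iff {D : Set G} {ε : ℤ} :
    (∀ z, z ∈ gridPoint t s₀ s₁ ⁻¹' D ↔ (z.1 - 2 * ε * z.2 : ZMod 5) = 0) ↔
      ∀ x, (word s₀ s₁ 1 x * t ∈ D ↔ codeForm ε 0 x = 0) ∧
        (word s₀ s₁ 1 x ∈ D ↔ codeForm ε 0 x = (3 : ℕ)) := by
  have heven : ∀ i q : ℤ, ((2 * i : ℤ) - 2 * ε * q : ZMod 5) = 0 ↔ codeForm ε 0 (i, q, 0) = 0 := by
    have key : ∀ y : ZMod 5, 2 * y = 0 ↔ y = 0 := by decide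
    intro i q
    rw [← key (codeForm ε 0 (i, q, 0)), codeForm_apply]
    push_cast
    ring_nf
  have hodd : ∀ i q : ℤ, ((2 * i - 1 : ℤ) - 2 * ε * q : ZMod 5) = 0 ↔
      codeForm ε 0 (i, q, 0) = (3 : ℕ) := by
    have key : ∀ y : ZMod 5, 2 * y - 1 = 0 ↔ y = (3 : ℕ) := by decide
    intro i q
    rw [← key (codeForm ε 0 (i, q, 0)), codeForm_apply]
    push_cast
    ring_nf
  constructor
  · rintro h ⟨i, q, r⟩
    have hword : word s₀ s₁ 1 (i, q, r) = word s₀ s₁ 1 (i, q, 0) := by simp [word]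
    have hform : codeForm ε 0 (i, q, r) = codeForm ε 0 (i, q, 0) := by simp [codeForm_apply]
    rw [hword, hform, ← heven, ← hodd, ← gridPoint_two_mul,
      ← gridPoint_two_mul_sub_one (t := t)]
    exact ⟨h _, h _⟩
  · rintro h ⟨p, q⟩
    obtain ⟨i, rfl | rfl⟩ : ∃ i, p = 2 * i ∨ p = 2 * i - 1 := ⟨(p + 1) / 2, by omega⟩
    · rw [Set.mem_preimage, gridPoint_two_mul, heven]
      exact (h _).1
    · rw [Set.mem_preimage, gridPoint_two_mul_sub_one, hodd]
      exact (h _).2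

lemma conditionTwo_one_iff {m : ℕ} (hm : 0 < m) {ε : ℤ} :
    ConditionTwo s₀ s₁ 1 m 1 ε 0 ↔ ConditionOne s₀ s₁ m (-ε) := by
  simp only [ConditionTwo, ConditionOne, neg_mul, ← sub_eq_add_neg]
  constructor
  · rintro ⟨h5, w, hw, -, -, -, -, h, -⟩
    exact ⟨h5, w, hw, h⟩
  · rintro ⟨h5, w, hw, h⟩
    exact ⟨h5, w, hw, 0, by omega, 0, hm, h, by simp⟩

lemma codeTwo_one_eq {m : ℕ} {ε : ℤ} :
    codeTwo t s₀ s₁ 1 m 1 3 ε 0 = codeOne t s₀ s₁ m ε := by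
  have hcomm : ∀ w k : ℕ, 5 * (w : ℤ) + ε * k + 3 = 3 + 5 * w + ε * k := fun w k => by ring
  rw [codeTwo, codeOne, Set.iUnion₂_comm]
  simp [hcomm, Set.pair_comm]

theorem IsGeneralizedDihedral.isPerfectCode_iff_eq_codeOne (hG : IsGeneralizedDihedral A t)
    (h₀ : s₀ ∈ A) (h₁ : s₁ ∈ A) (hs₀ : IsOfFinOrder s₀)
    (hS : IsQuarticConnectionSet {s₁, s₁⁻¹, t, t * s₀}) {m : ℕ}
    (hm : IsLeast {i : ℕ | 0 < i ∧ s₁ ^ i ∈ Subgroup.zpowers s₀} m) {D : Set G} :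
    (IsPerfectCode (SimpleGraph.mulCayley {s₁, s₁⁻¹, t, t * s₀}) D ∧ t ∈ D) ↔
      ∃ ε ∈ ({1, -1} : Set ℤ), ConditionOne s₀ s₁ m (-ε) ∧ D = codeOne t s₀ s₁ m ε := by
  have hrange : ({s₁, s₁⁻¹, t, t * s₀} : Set G) = Set.range (gridGenerator t s₀ s₁) := by
    ext
    simp only [gridGenerator, Matrix.range_cons, Matrix.range_empty, Set.union_empty]
    rfl
  rw [hrange] at hS ⊢
  have hl : IsLeast {i : ℕ | 0 < i ∧ (1 : G) ^ i ∈ Subgroup.closure {s₀, s₁}} 1 :=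
    ⟨⟨one_pos, by simp [one_mem]⟩, fun i hi => hi.1⟩
  have hgen : ∀ g, ∃ x, word s₀ s₁ 1 x = g ∨ word s₀ s₁ 1 x * t = g := by
    refine (hG.gridPoint_surjective h₀ h₁ hS).forall.2 fun z => ?_
    unfold gridPoint
    split_ifs
    exacts [⟨_, .inr rfl⟩, ⟨_, .inl rfl⟩]
  have ht : t ∈ D ↔ 0 ∈ gridPoint t s₀ s₁ ⁻¹' D := by simp [gridPoint, word]
  rw [hG.isPerfectCode_iff_isBipartiteCode_gridStep h₀ h₁ hS, ht, isBipartiteCode_gridStep_iff]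
  simp only [forall_gridPoint_mem_iff, hG.eq_codeTwo_iff h₀ h₁ (one_mem A) hs₀ hm hl hgen,
    conditionTwo_one_iff hm.1.1, codeTwo_one_eq]

end Grid

theorem theorem1p2_general {G : Type*} [Group G] (A : Subgroup G) (t : G)
    (hG : IsGeneralizedDihedral A t) (S : Set G) (hS : IsQuarticConnectionSet S) :
    (∀ (s₀ s₁ : G) (m : ℕ), s₀ ∈ A → s₁ ∈ A → IsOfFinOrder s₀ →
      S = {s₁, s₁⁻¹, t, t * s₀} →
      IsLeast {i : ℕ | 0 < i ∧ s₁ ^ i ∈ Subgroup.zpowers s₀} m →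
      ∀ D : Set G, (IsPerfectCode (SimpleGraph.mulCayley S) D ∧ t ∈ D) ↔
        ∃ ε ∈ ({1, -1} : Set ℤ), ConditionOne s₀ s₁ m (-ε) ∧ D = codeOne t s₀ s₁ m ε) ∧
    (∀ (s₀ s₁ s₂ : G) (m l : ℕ), s₀ ∈ A → s₁ ∈ A → s₂ ∈ A → IsOfFinOrder s₀ →
      S = {t, t * s₀, t * s₁, t * s₂} →
      IsLeast {i : ℕ | 0 < i ∧ s₁ ^ i ∈ Subgroup.zpowers s₀} m →
      IsLeast {i : ℕ | 0 < i ∧ s₂ ^ i ∈ Subgroup.closure {s₀, s₁}} l →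
      ∀ D : Set G, (IsPerfectCode (SimpleGraph.mulCayley S) D ∧ t ∈ D) ↔
        ∃ (v : ℕ) (a b : ℤ), AdmissibleTriple v a b ∧ ConditionTwo s₀ s₁ s₂ m l a b ∧
          D = codeTwo t s₀ s₁ s₂ m l v a b) := by
  constructor
  · rintro s₀ s₁ m h₀ h₁ hs₀ rfl hm D
    exact hG.isPerfectCode_iff_eq_codeOne h₀ h₁ hs₀ hS hm
  · rintro s₀ s₁ s₂ m l h₀ h₁ h₂ hs₀ rfl hm hl D
    exact hG.isPerfectCode_iff_eq_codeTwo h₀ h₁ h₂ hs₀ hS hm hl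

theorem theorem1p2 {G : Type*} [Group G] [Finite G] (A : Subgroup G) (t : G)
    (hG : IsGeneralizedDihedral A t) (S : Set G) (hS : IsQuarticConnectionSet S) (ht : t ∈ S)
    (hcode : ∃ D : Set G, IsPerfectCode (SimpleGraph.mulCayley S) D) :
    (∀ (s₀ s₁ : G) (m : ℕ), s₀ ∈ A → s₁ ∈ A →
      S = {s₁, s₁⁻¹, t, t * s₀} →
      IsLeast {i : ℕ | 0 < i ∧ s₁ ^ i ∈ Subgroup.zpowers s₀} m →
      (∃ δ ∈ ({1, -1} : Set ℤ), ConditionOne s₀ s₁ m δ) →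
      ∀ D : Set G, (IsPerfectCode (SimpleGraph.mulCayley S) D ∧ t ∈ D) ↔
        ∃ ε ∈ ({1, -1} : Set ℤ), ConditionOne s₀ s₁ m (-ε) ∧ D = codeOne t s₀ s₁ m ε) ∧
    (∀ (s₀ s₁ s₂ : G) (m l : ℕ), s₀ ∈ A → s₁ ∈ A → s₂ ∈ A →
      S = {t, t * s₀, t * s₁, t * s₂} →
      IsLeast {i : ℕ | 0 < i ∧ s₁ ^ i ∈ Subgroup.zpowers s₀} m →
      IsLeast {i : ℕ | 0 < i ∧ s₂ ^ i ∈ Subgroup.closure {s₀, s₁}} l →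
      (∃ (v : ℕ) (a b : ℤ), AdmissibleTriple v a b ∧ ConditionTwo s₀ s₁ s₂ m l a b) →
      ∀ D : Set G, (IsPerfectCode (SimpleGraph.mulCayley S) D ∧ t ∈ D) ↔
        ∃ (v : ℕ) (a b : ℤ), AdmissibleTriple v a b ∧ ConditionTwo s₀ s₁ s₂ m l a b ∧
          D = codeTwo t s₀ s₁ s₂ m l v a b) := by
  obtain ⟨codes_one, codes_two⟩ := theorem1p2_general A t hG S hS
  exact ⟨fun s₀ s₁ m h₀ h₁ hS hm _ => codes_one s₀ s₁ m h₀ h₁ (isOfFinOrder_of_finite s₀) hS hm,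
    fun s₀ s₁ s₂ m l h₀ h₁ h₂ hS hm hl _ =>
      codes_two s₀ s₁ s₂ m l h₀ h₁ h₂ (isOfFinOrder_of_finite s₀) hS hm hl⟩
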